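/- **Setting.** For $k>1$ and $\lambda\ge\sigma>0$ let $\mathcal D(k,\lambda,\sigma)$ be the set of probability laws $D$ on $\mathbb R$ with a mean $\mu(D)\in[-\lambda,\lambda]$ and $\mathbb E_{X\sim D}|X-\mu(D)|^k\le\sigma^k$. A 1-bit mean estimator uses $n$ i.i.d. samples $X_1,\dots,X_n\sim D$; from each $X_t$ it sees only the bit $Q_t(X_t)$, where $Q_t:\mathbb R\to\{0,1\}$ is a query chosen by the estimator, which may use internal randomness independent of the samples. It uses $r$ rounds of adaptivity if the samples are split into $r$ rounds and each query depends only on the internal randomness and on the answers from strictly earlier rounds. It is $(\epsilon,\delta)$-PAC for $\mathcal D(k,\lambda,\sigma)$ if, for every $D$ in this family, its output $\hat\mu$ satisfies $\Pr(|\hat\mu-\mu(D)|\le\epsilon)\ge1-\delta$. A threshold query is a query $\mathbf 1\{x\le\gamma\}$ or $\mathbf 1\{x\ge\gamma\}$. **The two-stage estimator.** Put $\kappa=\min(k,3)$, $\bar\epsilon=\min(\epsilon,\sigma)$, and let $c_T,c_N>0$ be constants. *Round 1 (Gray-code localization).* For $\ell\ge1$ let $g_\ell(x)=1$ if $\lfloor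 2^\ell\max(0,\min(1,x))\rfloor \bmod 4\in\{1,2\}$ and $g_\ell(x)=0$ otherwise. Let $M=\max(0,\lfloor\log_2(\lambda/\sigma)-1-2/\kappa\rfloor)$ and, if $M\ge1$, $J=\lceil 8\ln(2M/\delta)\rceil$. For each $\ell\le M$ apply the query $x\mapsto g_\ell\big(\tfrac{x+\lambda}{2\lambda}\big)$ to $J$ fresh samples, and let $\hat z_\ell$ be $1$ if at least $J/2$ of the answers are $1$ and $0$ otherwise. Let $x_0=\inf\{x\in[0,1]:g_\ell(x)=\hat z_\ell\ (1\le\ell\le M)\}$, $[L',U']=[x_0-2^{-(M+2)},\,x_0+2^{-M}+2^{-(M+2)}]\cap[0,1]$, and let $c$ be the midpoint of $[2\lambda L'-\lambda,\,2\lambda U'-\lambda]$. (If $M=0$ no samples are used and $c=0$.) *Round 2 (refinement).* Let $t=c_T\,\sigma(\sigma/\bar\epsilon)^{1/(\kappa-1)}$, $i_{\max}=\max(0,\lceil\log_2(t/\sigma)\rceil)$, $m_0=0$, $m_i=2^i$ for $i\ge1$, $a_i=\sigma m_{i-1}$, $b_i=\sigma m_i$, $n_i=\lceil c_N(\sigma/\bar\epsilon)^2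 2^{i(2-\kappa)}\rceil$. For each $1\le i\le i_{\max}$ and each sign $s=\pm1$ make $n_i$ queries, each on a fresh sample, of each of the four types $\mathbf 1\{s(x-c)\ge a_i\}$, $\mathbf 1\{s(x-c)\ge T\}$, $\mathbf 1\{s(x-c)\ge T\}$, $\mathbf 1\{s(x-c)\ge b_i\}$, where every $T\sim\mathrm{Unif}(a_i,b_i)$ is drawn afresh. Let $\hat p_a$ be the empirical mean of the first type minus that of the second, and $\hat p_b$ that of the third minus that of the fourth. The base estimate is $\sum_{i,s}s\,(a_i\hat p_a+b_i\hat p_b)$. Make $K=\lceil8\ln(2/\delta)\rceil$ independent base estimates in parallel and output $\hat\mu=c+\text{(their median)}$. **Claim.** There are absolute constants $C_1,c_N>0$ and, for each $k>1$, constants $C_2,c_T>0$ depending only on $k$, such that for all $\lambda\ge\sigma>0$, $\epsilon>0$ and $\delta\in(0,1)$ the two-stage estimator with the constants $c_T,c_N$ is $(\epsilon,\delta)$-PAC for $\mathcal D(k,\lambda,\sigma)$, and its number of samples satisfies $$n\;\le\; C_1\,\log\!\Big(\frac\lambda\sigma\Big)\cdot\log_*\!\Big(\frac{\log(\lambda/\sigma)}{\delta}\Big)\;+\;C_2\cdot\begin{cases}\rho^2\,\log_*(1/\delta)&\text{if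 }k>2,\\ \rho^2\,\log_*(\rho)\,\log_*(1/\delta)&\text{if }k=2,\\ \rho^{k/(k-1)}\,\log_*(1/\delta)&\text{if }1<k<2,\end{cases}$$ where $\rho=\max(1,\sigma/\epsilon)$, $\log_*(u)=\max(1,\log u)$ for $u>0$, and the first term is read as $0$ if $\lambda=\sigma$. Furthermore, it uses only two rounds of adaptivity; the first uses general 1-bit queries (the Gray functions above) and the second uses only threshold queries. -/

import Mathlib

open MeasureTheory

noncomputable section

/-- The family `𝒟(k, lam, σ)` of laws on `ℝ` with mean in `[-lam, lam]` and `k`-th central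
moment at most `σ ^ k`. -/
def momentFamily (k lam σ : ℝ) : Set (Measure ℝ) :=
  {D | IsProbabilityMeasure D ∧
    Integrable (fun x : ℝ => x) D ∧
    (∫ x, x ∂D) ∈ Set.Icc (-lam) lam ∧
    Integrable (fun x : ℝ => |x - ∫ y, y ∂D| ^ k) D ∧
    ∫ x, |x - ∫ y, y ∂D| ^ k ∂D ≤ σ ^ k}

/-- A (possibly randomized) 1-bit mean estimator whose interaction is organised in rounds.

Every slot `i` stands for one fresh sample `X i`, to which the 1-bit query `query i` is applied.
All queries of one round are issued simultaneously: by `causal`, the choice of a query may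
depend on the internal randomness (the seed) and on the answers of strictly earlier rounds only.
A fully sequential protocol has `Slot = Fin n`, `rounds = n` and `round = id`; a non-adaptive one
has `rounds = 1`. -/
structure OneBitEstimator where
  /-- the samples used -/
  Slot : Type
  [slotFintype : Fintype Slot]
  /-- the internal randomness -/
  Seed : Type
  [seedMeasurableSpace : MeasurableSpace Seed]
  seedLaw : Measure Seed
  [seedProbability : IsProbabilityMeasure seedLaw]
  /-- the number of rounds of interaction -/
  rounds : ℕ
  round : Slot → Fin rounds
  /-- the quantization function for a slot, given the seed and the answers so far -/
  query : Slot → Seed → (Slot → Bool) → ℝ → Bool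
  causal : ∀ (i : Slot) (s : Seed) (y y' : Slot → Bool),
    (∀ j, round j < round i → y j = y' j) → query i s y = query i s y'
  measurable_query : ∀ (i : Slot) (y : Slot → Bool),
    Measurable fun p : Seed × ℝ => query i p.1 y p.2
  /-- the estimation rule, applied to the transcript -/
  estimate : Seed → (Slot → Bool) → ℝ
  measurable_estimate : ∀ y : Slot → Bool, Measurable fun s => estimate s y

attribute [instance] OneBitEstimator.slotFintype OneBitEstimator.seedMeasurableSpace
  OneBitEstimator.seedProbability

namespace OneBitEstimator

/-- The number of samples (equivalently, of transmitted bits). -/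
def numSamples (E : OneBitEstimator) : ℕ := Fintype.card E.Slot

/-- The bit `Y i = Q i (X i)` sent for slot `i` when the seed is `s` and the samples are `x`;
the query `Q i` is chosen from the answers of the earlier rounds. -/
def answer (E : OneBitEstimator) (s : E.Seed) (x : E.Slot → ℝ) (i : E.Slot) : Bool :=
  E.query i s (fun j => if _h : E.round j < E.round i then E.answer s x j else false) (x i)
termination_by (E.round i : ℕ)
decreasing_by exact _h

/-- The final estimate. -/
def output (E : OneBitEstimator) (s : E.Seed) (x : E.Slot → ℝ) : ℝ :=
  E.estimate s (E.answer s x)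

/-- `(ε, δ)`-PAC for a family of laws: for i.i.d. samples from any member, independent of the
internal randomness, the estimate is `ε`-correct with probability at least `1 - δ`. -/
def IsPAC (E : OneBitEstimator) (𝒟 : Set (Measure ℝ)) (ε δ : ℝ) : Prop :=
  ∀ D ∈ 𝒟, ENNReal.ofReal (1 - δ) ≤
    (E.seedLaw.prod (Measure.pi fun _ : E.Slot => D))
      {p | |E.output p.1 p.2 - ∫ x, x ∂D| ≤ ε}

end OneBitEstimator

/-- Threshold queries: `1{x ≤ γ}` or `1{x ≥ γ}`. -/
def IsThresholdQuery (Q : ℝ → Bool) : Prop :=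
  ∃ γ : ℝ, (∀ x, Q x = true ↔ x ≤ γ) ∨ (∀ x, Q x = true ↔ γ ≤ x)

/-! ### First round: Gray-code localization -/

/-- The `ℓ`-th Gray function, evaluated after truncation to `[0, 1]`. -/
def grayFun (ℓ : ℕ) (x : ℝ) : Bool :=
  let r := ⌊(2 : ℝ) ^ ℓ * max 0 (min 1 x)⌋ % 4
  decide (r = 1 ∨ r = 2)

/-- The points of `[0, 1]` whose first `M` Gray bits are `z 0, …, z (M - 1)`
(`z ℓ` being bit number `ℓ + 1`). -/
def grayDecode (M : ℕ) (z : Fin M → Bool) : Set ℝ :=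
  {x | x ∈ Set.Icc (0 : ℝ) 1 ∧ ∀ ℓ : Fin M, grayFun (ℓ + 1) x = z ℓ}

/-- The number of Gray bits, `⌊log₂ (lam / σ) - 1 - 2 / κ⌋`. It is zero (no localization, the
interval is all of `[-lam, lam]`) if that number is less than `1`. -/
def grayBits (κ lam σ : ℝ) : ℕ := ⌊Real.logb 2 (lam / σ) - 1 - 2 / κ⌋₊

/-- The number of samples for each of the `M` bits. -/
def graySamples (M : ℕ) (δ : ℝ) : ℕ := ⌈8 * Real.log (2 * M / δ)⌉₊

/-- Majority vote. -/
def majority {J : ℕ} (v : Fin J → Bool) : Bool :=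
  decide ((J : ℝ) / 2 ≤ ((Finset.univ.filter fun j => v j = true).card : ℝ))

/-- Left endpoint of the decoded dyadic interval `[x₀, x₀ + 2 ^ (-M)]`. -/
def grayBase (M : ℕ) (z : Fin M → Bool) : ℝ := sInf (grayDecode M z)

/-- Left endpoint, in the scale of `[0, 1]`, of the interval obtained from the decoded one by
moving both endpoints outwards by `2 ^ (-(M + 2))` and intersecting with `[0, 1]`. -/
def widenedLeft (M : ℕ) (z : Fin M → Bool) : ℝ :=
  max 0 (grayBase M z - ((2 : ℝ) ^ (M + 2))⁻¹)

/-- Right endpoint of the widened interval. -/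
def widenedRight (M : ℕ) (z : Fin M → Bool) : ℝ :=
  min 1 (grayBase M z + ((2 : ℝ) ^ M)⁻¹ + ((2 : ℝ) ^ (M + 2))⁻¹)

/-- The midpoint of the interval `[2 lam L' - lam, 2 lam U' - lam]` returned by the localization,
where `[L', U']` is the widened interval decoded from the majority votes. -/
def localizationCenter (lam : ℝ) {M J : ℕ} (y : Fin M × Fin J → Bool) : ℝ :=
  let z : Fin M → Bool := fun ℓ => majority fun j => y (ℓ, j)
  ((2 * lam * widenedLeft M z - lam) + (2 * lam * widenedRight M z - lam)) / 2

/-! ### Second round: refinement by randomized threshold queries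

The samples are recentred at the midpoint `c` of the localization interval. Index `i : Fin iMax`
together with a sign stands for the region `± σ [m i, m (i + 1))`, where `m 0 = 0` and
`m i = 2 ^ i` for `i ≥ 1`. -/

/-- Region boundaries in units of `σ`. -/
def gridPoint (i : ℕ) : ℝ := if i = 0 then 0 else 2 ^ i

/-- The number of regions on each side, `⌈log₂ (t / σ)⌉`, for the cutoff
`t = cT σ (σ / ε) ^ (1 / (κ - 1))`. -/
def numRegions (cT κ σ ε : ℝ) : ℕ := ⌈Real.logb 2 (cT * (σ / ε) ^ (1 / (κ - 1)))⌉₊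

/-- The sample allocation `⌈cN (σ / ε) ^ 2 2 ^ (i (2 - κ))⌉` of the `i`-th region. -/
def regionSamples (cN κ σ ε : ℝ) (i : ℕ) : ℕ :=
  ⌈cN * (σ / ε) ^ 2 * (2 : ℝ) ^ ((i : ℝ) * (2 - κ))⌉₊

/-- The number of independent repetitions of the base estimator. -/
def numBatches (δ : ℝ) : ℕ := ⌈8 * Real.log (2 / δ)⌉₊

/-- The samples of the second round: a batch, a region (index and sign, `true` for the
positive side), one of four kinds of queries, and a repetition number. -/
abbrev RefinementSlot (cT cN κ σ ε δ : ℝ) : Type :=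
  Fin (numBatches δ) × (Σ i : Fin (numRegions cT κ σ ε),
    Bool × Fin 4 × Fin (regionSamples cN κ σ ε (i + 1)))

/-- The sign as a real number. -/
def signOf (b : Bool) : ℝ := if b then 1 else -1

/-- The threshold of a query on a region with endpoints `a < b`, where `T = a + (b - a) u` is
uniform on `(a, b)` if `u` is uniform on `[0, 1]`. The four kinds of queries have thresholds
`a`, `T`, `b` and (a fresh) `T`. -/
def queryThreshold (q : Fin 4) (a b u : ℝ) : ℝ :=
  if q = 0 then a else if q = 2 then b else a + (b - a) * u

/-- The query `1{± (x - c) ≥ threshold}`, which is a threshold query in `x`. -/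
def refinementQuery {cT cN κ σ ε δ : ℝ} (c : ℝ) (r : RefinementSlot cT cN κ σ ε δ) (u x : ℝ) :
    Bool :=
  decide (queryThreshold r.2.2.2.1 (σ * gridPoint r.2.1) (σ * gridPoint (r.2.1 + 1)) u
    ≤ signOf r.2.2.1 * (x - c))

/-- Empirical mean of `n` bits. -/
def bitMean {n : ℕ} (v : Fin n → Bool) : ℝ :=
  ((Finset.univ.filter fun j => v j = true).card : ℝ) / n

/-- The base estimate of a batch (relative to the centre): the sum over all regions `±[a, b)` of
`±(a p̂ₐ + b p̂_b)`, where `p̂ₐ` and `p̂_b` are the empirical versions of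
`p_a = P(± X ≥ a) - P(± X ≥ T)` and `p_b = P(± X ≥ T) - P(± X ≥ b)`. -/
def baseEstimate {cT cN κ σ ε δ : ℝ} (y : RefinementSlot cT cN κ σ ε δ → Bool)
    (j : Fin (numBatches δ)) : ℝ :=
  ∑ i : Fin (numRegions cT κ σ ε), ∑ b : Bool,
    let avg : Fin 4 → ℝ := fun q => bitMean fun m => y (j, ⟨i, b, q, m⟩)
    signOf b * (σ * gridPoint i * (avg 0 - avg 1) + σ * gridPoint (i + 1) * (avg 3 - avg 2))

/-- The (lower) median of `K` real numbers. -/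
def median {K : ℕ} (v : Fin K → ℝ) : ℝ :=
  sInf {x : ℝ | K ≤ 2 * (Finset.univ.filter fun j => v j ≤ x).card}

lemma measurable_grayFun (ℓ : ℕ) : Measurable (grayFun ℓ) := by
  have h : Measurable fun x : ℝ => ⌊(2 : ℝ) ^ ℓ * max 0 (min 1 x)⌋ :=
    Int.measurable_floor.comp (by fun_prop)
  exact (measurable_from_top (f := fun n : ℤ => decide (n % 4 = 1 ∨ n % 4 = 2))).comp h

lemma measurable_queryThreshold (q : Fin 4) (a b : ℝ) : Measurable (queryThreshold q a b) := by
  unfold queryThreshold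
  split_ifs <;> fun_prop

/-- The two-stage estimator, with operative parameters `κ, ε, δ` and the constants `cT`
(in the cutoff) and `cN` (in the sample allocation). The seed consists of independent uniform
variables, one for each sample of the second round. -/
def twoStageCore (cT cN κ lam σ ε δ : ℝ) : OneBitEstimator where
  Slot := (Fin (grayBits κ lam σ) × Fin (graySamples (grayBits κ lam σ) δ)) ⊕
    RefinementSlot cT cN κ σ ε δ
  Seed := RefinementSlot cT cN κ σ ε δ → unitInterval
  seedLaw := volume
  rounds := 2
  round := Sum.elim (fun _ => 0) (fun _ => 1)
  query i s y x :=
    match i with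
    | Sum.inl (ℓ, _) => grayFun (ℓ + 1) ((x + lam) / (2 * lam))
    | Sum.inr r => refinementQuery (localizationCenter lam fun p => y (Sum.inl p)) r (s r) x
  causal := by
    rintro (⟨ℓ, j⟩ | r) s y y' h
    · rfl
    · have h' : (fun p => y (Sum.inl p)) = fun p => y' (Sum.inl p) := by
        funext p
        exact h _ (by simp)
      simp only [h']
  measurable_query := by
    rintro (⟨ℓ, j⟩ | r) y
    · exact (measurable_grayFun _).comp (by fun_prop)
    · refine measurable_to_bool ?_
      have h1 : Measurable fun p : (RefinementSlot cT cN κ σ ε δ → unitInterval) × ℝ =>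
          queryThreshold r.2.2.2.1 (σ * gridPoint r.2.1) (σ * gridPoint (r.2.1 + 1))
            (p.1 r : ℝ) :=
        (measurable_queryThreshold _ _ _).comp
          (measurable_subtype_coe.comp ((measurable_pi_apply r).comp measurable_fst))
      have h2 : Measurable fun p : (RefinementSlot cT cN κ σ ε δ → unitInterval) × ℝ =>
          signOf r.2.2.1 * (p.2 - localizationCenter lam fun q => y (Sum.inl q)) := by
        fun_prop
      simpa [Set.preimage, refinementQuery] using measurableSet_le h1 h2
  estimate _ y :=
    (localizationCenter lam fun p => y (Sum.inl p)) +
      median (baseEstimate fun r : RefinementSlot cT cN κ σ ε δ => y (Sum.inr r))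
  measurable_estimate _ := measurable_const

/-- The two-stage estimator for the family `momentFamily k lam σ`: moment orders above `3` are
treated as order `3`, and target accuracies above `σ` as accuracy `σ`. -/
def twoStageEstimator (cT cN k lam σ ε δ : ℝ) : OneBitEstimator :=
  twoStageCore cT cN (min k 3) lam σ (min ε σ) δ

/-- The tail-dependent refinement term with `ρ = max 1 (σ / ε)`; logarithms are replaced by `1`
where they are smaller than `1`. -/
def refinementRate (k σ ε δ : ℝ) : ℝ :=
  let ρ := max 1 (σ / ε)
  if 2 < k then ρ ^ 2 * max 1 (Real.log (1 / δ))
  else if k = 2 then ρ ^ 2 * max 1 (Real.log ρ) * max 1 (Real.log (1 / δ))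
  else ρ ^ (k / (k - 1)) * max 1 (Real.log (1 / δ))

end

/-! Localization. Rescale `[-lam, lam]` to `[0, 1]` and let `m` be the rescaled mean. The `ℓ`-th
Gray function can jump only at odd multiples of `2 ^ (-ℓ)`, and such points for different `ℓ ≤ M`
are at least `2 ^ (-M)` apart. So at most one of the first `M` functions jumps within `2 ^ (-(M +
2))` of `m` (`unstable_level_unique`). At every other level Markov's inequality makes a sample's bit
wrong with probability at most `1/4`, which the majority vote repairs. The vote at the exceptional
level may go either way: a wrong bit there still encodes a point just across the jump
(`exists_near_of_stable`). Hence the centre `c` is within `24 σ` of the mean, except with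
probability `δ / 2`.

Refinement. Averaging over a threshold uniform on `(a, b)` turns threshold bits into an unbiased
estimate of the part of `y` in `[a, b)` (`sum_queryWeight_mul_integral`). A base estimate is
therefore unbiased for the mean of `X - c` truncated at some `B`; the bias is at most `E|X - c|^κ /
B^(κ-1)`, and the cutoff makes it at most `ε / 2`. Region `i` contributes to the variance at most a
constant times `b_i² / n_i` times the tail probability at `a_i`. The allocation makes `b_i² / n_i`
at most `ε² 2^(κ i) / cN`, and summed inside the expectation these weights are controlled by a
single `κ`-th moment (`sum_grid_indicator_le`), with no loss in the number of regions. Chebyshev's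
inequality gives failure probability `1/4` per batch, and the median boosts this to `δ / 2`.

Combination and cost. The second round sees the first only through a finite bit vector, so its bound
may be proved for a fixed centre. The sample sizes `n_i` grow with ratio `2 ^ (2 - κ)`, which is
below, equal to or above `1` in the three regimes. Capping the order at `3` keeps `C₁` and `cN`
absolute and leaves the rate for `k > 2` unchanged. -/

/-! ### Concentration, medians and nesting of the moment families. -/

open ProbabilityTheory in
/-- If `n` independent events each have probability at most `1/4`, then at least half of them
occur with probability at most `exp (-n / 8)`. -/
lemma measureReal_half_le_card_le_exp {Ω : Type*} [MeasurableSpace Ω] {μ : Measure Ω}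
    [IsProbabilityMeasure μ] {n : ℕ} {A : Fin n → Ω → Bool} (hA : ∀ i, Measurable (A i))
    (hind : iIndepFun A μ) (hp : ∀ i, μ.real {ω | A i ω = true} ≤ 1 / 4) :
    μ.real {ω | n ≤ 2 * (Finset.univ.filter fun i => A i ω = true).card} ≤
      Real.exp (-n / 8) := by
  set X : Fin n → Ω → ℝ := fun i ω => if A i ω = true then 1 else 0 with hX
  have hφ : Measurable fun b : Bool => (if b = true then (1 : ℝ) else 0) := measurable_from_top
  have hXm : ∀ i, Measurable (X i) := fun i => hφ.comp (hA i)
  have hEX : ∀ i, μ[X i] = μ.real {ω | A i ω = true} := by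
    intro i
    have h : X i = Set.indicator {ω | A i ω = true} 1 := by
      ext ω
      simp [hX, Set.indicator_apply]
    rw [h, integral_indicator_one]
    exact hA i (measurableSet_singleton true)
  have hind' : iIndepFun (fun i ω => X i ω - μ[X i]) μ :=
    hind.comp (fun i b => (if b = true then (1 : ℝ) else 0) - ∫ ω, X i ω ∂μ)
      (fun i => measurable_from_top)
  have hsub : ∀ i ∈ (Finset.univ : Finset (Fin n)),
      HasSubgaussianMGF (fun ω => X i ω - μ[X i]) ((‖(1 : ℝ) - 0‖₊ / 2) ^ 2) μ := by
    intro i _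
    refine hasSubgaussianMGF_of_mem_Icc (hXm i).aemeasurable (Filter.Eventually.of_forall ?_)
    intro ω
    by_cases h : A i ω = true <;> simp [hX, h]
  -- The deviation is `n/2 - n/4`. Each centred indicator has sub-Gaussian parameter `1/4`, so the
  -- exponent is `(n/4)² / (2 · n/4) = n/8`.
  have hmain := HasSubgaussianMGF.measure_sum_ge_le_of_iIndepFun hind' hsub
    (ε := (n : ℝ) / 4) (by positivity)
  refine (measureReal_mono ?_).trans (hmain.trans (le_of_eq ?_))
  · intro ω hω
    have h1 : ∑ i, X i ω = ((Finset.univ.filter fun i => A i ω = true).card : ℝ) := by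
      simp [hX]
    have h2 : ∑ i, μ[X i] ≤ (n : ℝ) / 4 := by
      calc ∑ i, μ[X i] ≤ ∑ _i : Fin n, (1 / 4 : ℝ) :=
            Finset.sum_le_sum fun i _ => (hEX i).trans_le (hp i)
        _ = n / 4 := by simp; ring
    have h3 : (n : ℝ) ≤ 2 * ((Finset.univ.filter fun i => A i ω = true).card : ℝ) := by
      exact_mod_cast hω
    simp only [Set.mem_ofPred_eq, Finset.sum_sub_distrib, h1]
    linarith
  · rcases Nat.eq_zero_or_pos n with h | h
    · subst h; simp
    · congr 1
      have : (n : ℝ) ≠ 0 := by positivity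
      simp
      field_simp
      norm_num

/-- A random set whose choice is determined by a finite-valued function of the first coordinate
has small measure if all its values do. -/
lemma measure_prod_le_of_finite {X Y F : Type*} [MeasurableSpace X] [MeasurableSpace Y] [Fintype F]
    {μ : Measure X} {ν : Measure Y} [IsProbabilityMeasure μ] [SFinite ν] {f : X → F}
    (hf : ∀ a, MeasurableSet (f ⁻¹' {a})) {T : F → Set Y} {c : ENNReal} (hT : ∀ a, ν (T a) ≤ c) :
    (μ.prod ν) {p | p.2 ∈ T (f p.1)} ≤ c := by
  -- The sets `T a` need not be measurable: a finite cover by rectangles and subadditivity replace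
  -- integration over the fibres.
  have hsub : {p : X × Y | p.2 ∈ T (f p.1)} ⊆ ⋃ a ∈ (Finset.univ : Finset F),
      (f ⁻¹' {a}) ×ˢ T a := by
    intro p hp
    simp only [Finset.mem_univ, Set.iUnion_true, Set.mem_iUnion]
    exact ⟨f p.1, rfl, hp⟩
  calc (μ.prod ν) {p | p.2 ∈ T (f p.1)}
      ≤ ∑ a : F, (μ.prod ν) ((f ⁻¹' {a}) ×ˢ T a) :=
        (measure_mono hsub).trans (measure_biUnion_finset_le _ _)
    _ ≤ ∑ a : F, μ (f ⁻¹' {a}) * c := by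
        refine Finset.sum_le_sum fun a _ => ?_
        rw [Measure.prod_prod]
        gcongr
        exact hT a
    _ = μ (⋃ a ∈ (Finset.univ : Finset F), f ⁻¹' {a}) * c := by
        rw [← Finset.sum_mul, measure_biUnion_finset ?_ fun a _ => hf a]
        intro a _ b _ hab
        exact Disjoint.preimage f (by simpa using hab)
    _ ≤ c := mul_le_of_le_one_left zero_le prob_le_one

/-- The median is close to `m` if more than half of the values are. -/
lemma abs_median_sub_le {K : ℕ} {v : Fin K → ℝ} {m r : ℝ}
    (h : 2 * (Finset.univ.filter fun j => r < |v j - m|).card < K) : |median v - m| ≤ r := by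
  set S : Set ℝ := {x : ℝ | K ≤ 2 * (Finset.univ.filter fun j => v j ≤ x).card} with hS
  have hlow : ∀ x ∈ S, m - r ≤ x := by
    intro x hx
    by_contra! hlt
    have hsub : (Finset.univ.filter fun j => v j ≤ x) ⊆
        Finset.univ.filter fun j => r < |v j - m| := by
      intro j
      simp only [Finset.mem_filter, Finset.mem_univ, true_and]
      intro hj
      rw [lt_abs]
      right
      linarith
    have := Finset.card_le_card hsub
    simp only [hS, Set.mem_ofPred_eq] at hx
    omega
  have hmem : m + r ∈ S := by
    have hsub : (Finset.univ.filter fun j => ¬ r < |v j - m|) ⊆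
        Finset.univ.filter fun j => v j ≤ m + r := by
      intro j
      simp only [Finset.mem_filter, Finset.mem_univ, true_and, not_lt]
      intro hj
      linarith [(abs_le.1 hj).2]
    have h1 := Finset.card_le_card hsub
    have h2 := Finset.card_filter_add_card_filter_not (s := (Finset.univ : Finset (Fin K)))
      fun j => r < |v j - m|
    simp only [Finset.card_univ, Fintype.card_fin] at h2
    simp only [hS, Set.mem_ofPred_eq]
    omega
  rw [abs_le]
  have h1 : m - r ≤ sInf S := le_csInf ⟨_, hmem⟩ hlow
  have h2 : sInf S ≤ m + r := csInf_le ⟨m - r, hlow⟩ hmem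
  unfold median
  constructor <;> linarith

/-- The moment families decrease in the order of the moment. -/
lemma momentFamily_subset {k κ lam σ : ℝ} (hκ : 0 < κ) (hk : κ ≤ k) (hσ : 0 < σ) :
    momentFamily k lam σ ⊆ momentFamily κ lam σ := by
  rintro D ⟨hP, hI, hm, hIk, hle⟩
  have hk0 : 0 < k := hκ.trans_le hk
  -- Weighted AM-GM applied to `(x / σ) ^ k` and `1`, with weights `κ / k` and `1 - κ / k`. This
  -- pointwise bound gives both the integrability and the moment inequality.
  have hpt : ∀ x : ℝ, 0 ≤ x → x ^ κ ≤ σ ^ κ * (κ / k * (x ^ k / σ ^ k) + (1 - κ / k)) := by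
    intro x hx
    have h1 := Real.geom_mean_le_arith_mean2_weighted (w₁ := κ / k) (w₂ := 1 - κ / k)
      (p₁ := (x / σ) ^ k) (p₂ := 1) (by positivity)
      (by rw [sub_nonneg, div_le_one hk0]; exact hk) (by positivity) zero_le_one (by ring)
    rw [← Real.rpow_mul (by positivity), Real.one_rpow, mul_one, mul_div_cancel₀ _ hk0.ne',
      Real.div_rpow hx hσ.le, Real.div_rpow hx hσ.le, div_le_iff₀ (by positivity)] at h1
    linarith
  have hmeas : AEStronglyMeasurable (fun x : ℝ => |x - ∫ y, y ∂D| ^ κ) D := by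
    apply Measurable.aestronglyMeasurable
    fun_prop
  have hbd : Integrable (fun x : ℝ =>
      σ ^ κ * (κ / k * (|x - ∫ y, y ∂D| ^ k / σ ^ k) + (1 - κ / k))) D :=
    (((hIk.div_const _).const_mul _).add (integrable_const _)).const_mul _
  have hint : Integrable (fun x : ℝ => |x - ∫ y, y ∂D| ^ κ) D := by
    refine hbd.mono' hmeas (Filter.Eventually.of_forall fun x => ?_)
    rw [Real.norm_of_nonneg (by positivity)]
    exact hpt _ (abs_nonneg _)
  refine ⟨hP, hI, hm, hint, ?_⟩
  calc ∫ x, |x - ∫ y, y ∂D| ^ κ ∂D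
      ≤ ∫ x, σ ^ κ * (κ / k * (|x - ∫ y, y ∂D| ^ k / σ ^ k) + (1 - κ / k)) ∂D :=
        integral_mono hint hbd fun x => hpt _ (abs_nonneg _)
    _ = σ ^ κ * (κ / k * ((∫ x, |x - ∫ y, y ∂D| ^ k ∂D) / σ ^ k) + (1 - κ / k)) := by
        rw [integral_const_mul, integral_add ((hIk.div_const _).const_mul _) (integrable_const _),
          integral_const_mul, integral_div]
        simp
    _ ≤ σ ^ κ * (κ / k * 1 + (1 - κ / k)) := by
        gcongr
        rw [div_le_one (by positivity)]
        exact hle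
    _ = σ ^ κ := by ring

/-! ### Geometry of the Gray code. -/

lemma clamp_mem_Icc (x : ℝ) : max 0 (min 1 x) ∈ Set.Icc (0 : ℝ) 1 :=
  ⟨le_max_left _ _, max_le zero_le_one (min_le_left _ _)⟩

lemma clamp_eq_self {x : ℝ} (hx : x ∈ Set.Icc (0 : ℝ) 1) : max 0 (min 1 x) = x := by
  rw [min_eq_right hx.2, max_eq_right hx.1]

lemma abs_clamp_sub_le {x m : ℝ} (hm : m ∈ Set.Icc (0 : ℝ) 1) :
    |max 0 (min 1 x) - m| ≤ |x - m| := by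
  obtain ⟨h0, h1⟩ := hm
  rcases max_cases 0 (min 1 x) with ⟨h, h'⟩ | ⟨h, h'⟩ <;>
    rcases min_cases 1 x with ⟨h2, h2'⟩ | ⟨h2, h2'⟩ <;> rw [h] <;>
    rcases abs_cases (x - m) with ⟨h3, h3'⟩ | ⟨h3, h3'⟩ <;> rw [h3, abs_le] <;>
    constructor <;> linarith

lemma grayFun_clamp (ℓ : ℕ) (x : ℝ) : grayFun ℓ (max 0 (min 1 x)) = grayFun ℓ x := by
  simp only [grayFun, clamp_eq_self (clamp_mem_Icc x)]

lemma grayFun_eq_true_iff {ℓ : ℕ} {x : ℝ} (hx : x ∈ Set.Icc (0 : ℝ) 1) :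
    grayFun ℓ x = true ↔ ⌊(2 : ℝ) ^ ℓ * x⌋ % 4 = 1 ∨ ⌊(2 : ℝ) ^ ℓ * x⌋ % 4 = 2 := by
  simp [grayFun, clamp_eq_self hx]

/-- The indices of the dyadic cells containing a point of `[0, 1]`, with the cells at `1` closed
on the right, are obtained by appending binary digits and determine the Gray bits. -/
lemma exists_dyadic_index {x : ℝ} (hx : x ∈ Set.Icc (0 : ℝ) 1) :
    ∃ d : ℕ → ℤ, d 0 = 0 ∧ (∀ ℓ, d (ℓ + 1) = 2 * d ℓ ∨ d (ℓ + 1) = 2 * d ℓ + 1) ∧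
      (∀ ℓ, (d ℓ : ℝ) ≤ 2 ^ ℓ * x ∧ 2 ^ ℓ * x ≤ d ℓ + 1) ∧
      ∀ ℓ, grayFun (ℓ + 1) x = true ↔ d (ℓ + 1) % 4 = 1 ∨ d (ℓ + 1) % 4 = 2 := by
  rcases hx.2.lt_or_eq with h1 | h1
  · refine ⟨fun ℓ => ⌊(2 : ℝ) ^ ℓ * x⌋, ?_, ?_, ?_, ?_⟩
    · simp only [pow_zero, one_mul]
      exact Int.floor_eq_iff.2 ⟨by simpa using hx.1, by simpa using h1⟩
    · intro ℓ
      have e : (2 : ℝ) ^ (ℓ + 1) * x = 2 * (2 ^ ℓ * x) := by ring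
      simp only [e]
      set y := (2 : ℝ) ^ ℓ * x
      have ha := Int.floor_le y
      have hb := Int.lt_floor_add_one y
      have hc : 2 * ⌊y⌋ ≤ ⌊2 * y⌋ := by
        rw [Int.le_floor]
        push_cast
        linarith
      have hd : ⌊2 * y⌋ < 2 * ⌊y⌋ + 2 := by
        rw [Int.floor_lt]
        push_cast
        linarith
      omega
    · exact fun ℓ => ⟨Int.floor_le _, (Int.lt_floor_add_one _).le⟩
    · exact fun ℓ => grayFun_eq_true_iff hx
  -- At `x = 1` the floor `2 ^ ℓ` lies one past the last cell, hence the index `2 ^ ℓ - 1`. The Gray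
  -- bit is the same: the residues mod 4 are 2 and 1 at level one, 0 and 3 at later levels.
  · subst h1
    refine ⟨fun ℓ => 2 ^ ℓ - 1, by simp, ?_, ?_, ?_⟩
    · intro ℓ
      right
      simp only [pow_succ]
      ring
    · intro ℓ
      simp
    · intro ℓ
      have e : ⌊(2 : ℝ) ^ (ℓ + 1) * 1⌋ = 2 ^ (ℓ + 1) := by
        rw [mul_one]
        exact_mod_cast Int.floor_intCast (R := ℝ) (2 ^ (ℓ + 1))
      rw [grayFun_eq_true_iff hx, e]
      rcases ℓ with _ | ℓ
      · simp
      · have e2 : (2 : ℤ) ^ (ℓ + 1 + 1) = 4 * 2 ^ ℓ := by ring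
        simp only [e2]
        omega

/-- Points of `[0, 1]` with the same first `M` Gray bits have distance at most `2 ^ (-M)`. -/
lemma sub_le_of_grayFun_eq {M : ℕ} {x y : ℝ} (hx : x ∈ Set.Icc (0 : ℝ) 1)
    (hy : y ∈ Set.Icc (0 : ℝ) 1) (h : ∀ ℓ : Fin M, grayFun (ℓ + 1) x = grayFun (ℓ + 1) y) :
    x - y ≤ ((2 : ℝ) ^ M)⁻¹ := by
  obtain ⟨d, d0, dS, dle, dg⟩ := exists_dyadic_index hx
  obtain ⟨e, e0, eS, ele, eg⟩ := exists_dyadic_index hy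
  have key : ∀ ℓ ≤ M, d ℓ = e ℓ := by
    intro ℓ
    induction ℓ with
    | zero => intro _; rw [d0, e0]
    | succ ℓ ih =>
      intro hℓ
      have h1 := ih (by omega)
      have h2 := dg ℓ
      have h3 := eg ℓ
      rw [h ⟨ℓ, by omega⟩] at h2
      have h4 := h2.symm.trans h3
      -- Of the two children `2d` and `2d + 1` of a cell, exactly one has residue 1 or 2 mod 4, so
      -- the Gray bit selects the child.
      rcases dS ℓ with a | a <;> rcases eS ℓ with b | b <;> omega
  have h1 := (dle M).2
  have h2 := (ele M).1
  rw [key M le_rfl] at h1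
  rw [← one_div, le_div_iff₀ (by positivity)]
  linarith

/-- Between two points with different `ℓ`-th Gray bits there is an odd multiple of `2 ^ (-ℓ)`. -/
lemma exists_odd_of_grayFun_ne {ℓ : ℕ} {u v : ℝ} (hu : u ∈ Set.Icc (0 : ℝ) 1)
    (hv : v ∈ Set.Icc (0 : ℝ) 1) (huv : u ≤ v) (h : grayFun ℓ u ≠ grayFun ℓ v) :
    ∃ o : ℤ, o % 2 = 1 ∧ 2 ^ ℓ * u < o ∧ (o : ℝ) ≤ 2 ^ ℓ * v := by
  have hab : ⌊(2 : ℝ) ^ ℓ * u⌋ ≤ ⌊(2 : ℝ) ^ ℓ * v⌋ := Int.floor_le_floor (by gcongr)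
  rw [Ne, Bool.eq_iff_iff, grayFun_eq_true_iff hu, grayFun_eq_true_iff hv] at h
  -- The bit changes only when the floor enters an odd value. If the floor at `v` is even, it shares
  -- its bit with its predecessor, so that predecessor is odd and still exceeds the floor at `u`.
  have : ∃ o : ℤ, o % 2 = 1 ∧ ⌊(2 : ℝ) ^ ℓ * u⌋ < o ∧ o ≤ ⌊(2 : ℝ) ^ ℓ * v⌋ := by
    by_cases hodd : ⌊(2 : ℝ) ^ ℓ * v⌋ % 2 = 1
    · exact ⟨_, hodd, by omega, le_rfl⟩
    · exact ⟨⌊(2 : ℝ) ^ ℓ * v⌋ - 1, by omega, by omega, by omega⟩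
  obtain ⟨o, h1, h2, h3⟩ := this
  exact ⟨o, h1, Int.floor_lt.1 h2, Int.le_floor.1 h3⟩

/-- The same, phrased with the distance to one of the points. -/
lemma exists_odd_near {ℓ : ℕ} {x m w : ℝ} (hx : x ∈ Set.Icc (0 : ℝ) 1)
    (hm : m ∈ Set.Icc (0 : ℝ) 1) (hw : |x - m| < w) (h : grayFun ℓ x ≠ grayFun ℓ m) :
    ∃ o : ℤ, o % 2 = 1 ∧ |(o : ℝ) - 2 ^ ℓ * m| < 2 ^ ℓ * w := by
  have hp : (0 : ℝ) < 2 ^ ℓ := by positivity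
  rw [abs_lt] at hw
  rcases le_total x m with hxm | hxm
  · obtain ⟨o, h1, h2, h3⟩ := exists_odd_of_grayFun_ne hx hm hxm h
    exact ⟨o, h1, by rw [abs_lt]; constructor <;> nlinarith⟩
  · obtain ⟨o, h1, h2, h3⟩ := exists_odd_of_grayFun_ne hm hx hxm h.symm
    exact ⟨o, h1, by rw [abs_lt]; constructor <;> nlinarith⟩

/-- At most one of the first `M` Gray functions jumps within distance `2 ^ (-(M + 2))` of a
point. -/
lemma unstable_level_unique {M ℓ ℓ' : ℕ} {x x' m : ℝ} (hℓ : ℓ < ℓ') (hM : ℓ' ≤ M)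
    (hm : m ∈ Set.Icc (0 : ℝ) 1) (hx : x ∈ Set.Icc (0 : ℝ) 1) (hx' : x' ∈ Set.Icc (0 : ℝ) 1)
    (hw : |x - m| < ((2 : ℝ) ^ (M + 2))⁻¹) (hw' : |x' - m| < ((2 : ℝ) ^ (M + 2))⁻¹)
    (h : grayFun ℓ x ≠ grayFun ℓ m) (h' : grayFun ℓ' x' ≠ grayFun ℓ' m) : False := by
  obtain ⟨o, ho, h1⟩ := exists_odd_near hx hm hw h
  obtain ⟨o', ho', h2⟩ := exists_odd_near hx' hm hw' h'
  obtain ⟨a, rfl⟩ : ∃ a, ℓ' = ℓ + (a + 1) := ⟨ℓ' - ℓ - 1, by omega⟩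
  set W := ((2 : ℝ) ^ (M + 2))⁻¹ with hW
  have hpa : (0 : ℝ) < 2 ^ (a + 1) := by positivity
  -- In units of the finer level the coarse jump is an even integer and the fine one an odd integer.
  -- Both lie within `1/4` of the scaled `m`, so they would have to coincide.
  have h3 : |((2 ^ (a + 1) * o : ℤ) : ℝ) - 2 ^ (ℓ + (a + 1)) * m| < 2 ^ (ℓ + (a + 1)) * W := by
    have e1 : ((2 ^ (a + 1) * o : ℤ) : ℝ) - 2 ^ (ℓ + (a + 1)) * m =
        2 ^ (a + 1) * ((o : ℝ) - 2 ^ ℓ * m) := by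
      push_cast
      ring
    have e2 : (2 : ℝ) ^ (ℓ + (a + 1)) * W = 2 ^ (a + 1) * (2 ^ ℓ * W) := by ring
    rw [e1, abs_mul, abs_of_pos hpa, e2]
    exact mul_lt_mul_of_pos_left h1 hpa
  have h4 : (2 : ℝ) ^ (ℓ + (a + 1)) * W ≤ 1 / 4 := by
    rw [hW, ← div_eq_mul_inv, div_le_iff₀ (by positivity), pow_add 2 M 2]
    have : (2 : ℝ) ^ (ℓ + (a + 1)) ≤ 2 ^ M := pow_le_pow_right₀ one_le_two hM
    linarith
  have h5 : |((2 ^ (a + 1) * o - o' : ℤ) : ℝ)| < 1 := by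
    push_cast at h3 ⊢
    rw [abs_lt] at h2 h3 ⊢
    constructor <;> linarith
  have h6 : 2 ^ (a + 1) * o - o' = 0 := by
    rw [← Int.abs_lt_one_iff]
    exact_mod_cast h5
  have h7 : 2 ^ (a + 1) * o = 2 * (2 ^ a * o) := by ring
  omega

/-- If the decoded bits are correct at all levels at which the Gray function is constant near `m`,
then they are the bits of a point near `m`. -/
lemma exists_near_of_stable {M : ℕ} {m : ℝ} (hm : m ∈ Set.Icc (0 : ℝ) 1) {z : Fin M → Bool}
    (hz : ∀ ℓ : Fin M, (∀ x, |x - m| < ((2 : ℝ) ^ (M + 2))⁻¹ →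
      grayFun (ℓ + 1) x = grayFun (ℓ + 1) m) → z ℓ = grayFun (ℓ + 1) m) :
    ∃ x ∈ grayDecode M z, |x - m| ≤ ((2 : ℝ) ^ (M + 2))⁻¹ := by
  by_cases hall : ∀ ℓ : Fin M, z ℓ = grayFun (ℓ + 1) m
  · exact ⟨m, ⟨hm, fun ℓ => (hall ℓ).symm⟩, by simp⟩
  · push Not at hall
    obtain ⟨ℓ, hℓ⟩ := hall
    -- A wrong bit can only occur at a level with a nearby jump. A point across that jump has the
    -- opposite bit there, hence the decoded one, and agrees with `m` at all other levels, which are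
    -- stable.
    have h1 : ¬ ∀ x, |x - m| < ((2 : ℝ) ^ (M + 2))⁻¹ → grayFun (ℓ + 1) x = grayFun (ℓ + 1) m :=
      fun h => hℓ (hz ℓ h)
    push Not at h1
    obtain ⟨x, hxw, hxg⟩ := h1
    rw [← grayFun_clamp] at hxg
    have hxw' := (abs_clamp_sub_le (x := x) hm).trans_lt hxw
    have hx := clamp_mem_Icc x
    set x' := max 0 (min 1 x)
    have other : ∀ ℓ' : Fin M, ℓ' ≠ ℓ → ∀ y, |y - m| < ((2 : ℝ) ^ (M + 2))⁻¹ →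
        grayFun (ℓ' + 1) y = grayFun (ℓ' + 1) m := by
      intro ℓ' hne y hy
      by_contra hcon
      rw [← grayFun_clamp] at hcon
      have hy' := (abs_clamp_sub_le (x := y) hm).trans_lt hy
      rcases lt_or_gt_of_ne hne with hlt | hlt
      · exact unstable_level_unique (Nat.succ_lt_succ hlt) ℓ.2 hm (clamp_mem_Icc y) hx hy' hxw'
          hcon hxg
      · exact unstable_level_unique (Nat.succ_lt_succ hlt) ℓ'.2 hm hx (clamp_mem_Icc y) hxw' hy'
          hxg hcon
    refine ⟨x', ⟨hx, fun ℓ' => ?_⟩, hxw'.le⟩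
    by_cases hne : ℓ' = ℓ
    · subst hne
      revert hℓ hxg
      cases z ℓ' <;> cases grayFun (ℓ' + 1) m <;> cases grayFun (ℓ' + 1) x' <;> simp
    · rw [hz ℓ' (other ℓ' hne), other ℓ' hne x' hxw']

/-- The localization interval contains the scaled mean if the decoded bits are correct at all
levels at which the Gray function is constant near it. -/
lemma mem_widened_of_stable {M : ℕ} {m : ℝ} (hm : m ∈ Set.Icc (0 : ℝ) 1) {z : Fin M → Bool}
    (hz : ∀ ℓ : Fin M, (∀ x, |x - m| < ((2 : ℝ) ^ (M + 2))⁻¹ →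
      grayFun (ℓ + 1) x = grayFun (ℓ + 1) m) → z ℓ = grayFun (ℓ + 1) m) :
    m ∈ Set.Icc (widenedLeft M z) (widenedRight M z) := by
  obtain ⟨x, hx, hxm⟩ := exists_near_of_stable hm hz
  have h1 : grayBase M z ≤ x := csInf_le ⟨0, fun y hy => hy.1.1⟩ hx
  have h2 : x - ((2 : ℝ) ^ M)⁻¹ ≤ grayBase M z := by
    refine le_csInf ⟨x, hx⟩ fun y hy => ?_
    have := sub_le_of_grayFun_eq hx.1 hy.1 fun ℓ => (hx.2 ℓ).trans (hy.2 ℓ).symm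
    linarith
  rw [abs_le] at hxm
  exact ⟨max_le hm.1 (by linarith), le_min hm.2 (by linarith)⟩

lemma widenedRight_sub_widenedLeft_le (M : ℕ) (z : Fin M → Bool) :
    widenedRight M z - widenedLeft M z ≤ 3 / 2 * ((2 : ℝ) ^ M)⁻¹ := by
  have h1 : grayBase M z - ((2 : ℝ) ^ (M + 2))⁻¹ ≤ widenedLeft M z := le_max_right _ _
  have h2 : widenedRight M z ≤ grayBase M z + ((2 : ℝ) ^ M)⁻¹ + ((2 : ℝ) ^ (M + 2))⁻¹ :=
    min_le_right _ _
  have h3 : ((2 : ℝ) ^ (M + 2))⁻¹ = 1 / 4 * ((2 : ℝ) ^ M)⁻¹ := by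
    rw [pow_add, mul_inv]
    norm_num
    ring
  linarith

/-- The centre is close to the mean if all stable majority votes are correct. -/
lemma abs_localizationCenter_sub_le {lam μ : ℝ} (hlam : 0 < lam) (hμ : μ ∈ Set.Icc (-lam) lam)
    {M J : ℕ} {y : Fin M × Fin J → Bool}
    (hy : ∀ ℓ : Fin M, (∀ x, |x - (μ + lam) / (2 * lam)| < ((2 : ℝ) ^ (M + 2))⁻¹ →
      grayFun (ℓ + 1) x = grayFun (ℓ + 1) ((μ + lam) / (2 * lam))) →
      majority (fun j => y (ℓ, j)) = grayFun (ℓ + 1) ((μ + lam) / (2 * lam))) :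
    |localizationCenter lam y - μ| ≤ 3 / 2 * lam * ((2 : ℝ) ^ M)⁻¹ := by
  have hm : (μ + lam) / (2 * lam) ∈ Set.Icc (0 : ℝ) 1 := by
    constructor
    · exact div_nonneg (by linarith [hμ.1]) (by linarith)
    · rw [div_le_one (by linarith)]
      linarith [hμ.2]
  have h := mem_widened_of_stable hm (z := fun ℓ => majority fun j => y (ℓ, j)) hy
  have hw := widenedRight_sub_widenedLeft_le M fun ℓ => majority fun j => y (ℓ, j)
  have hμe : μ = 2 * lam * ((μ + lam) / (2 * lam)) - lam := by
    field_simp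
    ring
  set m := (μ + lam) / (2 * lam)
  unfold localizationCenter
  set a := widenedLeft M fun ℓ => majority fun j => y (ℓ, j)
  set b := widenedRight M fun ℓ => majority fun j => y (ℓ, j)
  rw [hμe, abs_le]
  obtain ⟨h1, h2⟩ := h
  constructor <;> simp only [] <;> nlinarith

lemma half_le_card_of_majority_ne {J : ℕ} {v : Fin J → Bool} {b : Bool} (h : majority v ≠ b) :
    J ≤ 2 * (Finset.univ.filter fun j => (v j != b) = true).card := by
  have hsum := Finset.card_filter_add_card_filter_not (s := (Finset.univ : Finset (Fin J)))
    fun j => v j = true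
  simp only [Finset.card_univ, Fintype.card_fin] at hsum
  unfold majority at h
  cases b with
  | true =>
    simp only [ne_eq, decide_eq_true_eq, not_le] at h
    have h' : 2 * (Finset.univ.filter fun j => v j = true).card < J := by
      have : 2 * ((Finset.univ.filter fun j => v j = true).card : ℝ) < J := by linarith
      exact_mod_cast this
    have e : (Finset.univ.filter fun j => (v j != true) = true) =
        Finset.univ.filter fun j => ¬ v j = true := by
      ext j; simp
    rw [e]
    omega
  | false =>
    simp only [ne_eq, decide_eq_false_iff_not, not_not] at h
    have h' : J ≤ 2 * (Finset.univ.filter fun j => v j = true).card := by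
      have : (J : ℝ) ≤ 2 * ((Finset.univ.filter fun j => v j = true).card : ℝ) := by linarith
      exact_mod_cast this
    simpa using h'

/-! ### Success probability of the localization. -/

/-- Markov's inequality for the central moment. -/
lemma measureReal_le_abs_sub_le {κ lam σ w : ℝ} (hκ : 0 < κ) (hw : 0 < w) {D : Measure ℝ}
    (hD : D ∈ momentFamily κ lam σ) :
    D.real {x | w ≤ |x - ∫ y, y ∂D|} ≤ σ ^ κ / w ^ κ := by
  obtain ⟨hP, hI, hm, hIk, hle⟩ := hD
  have h := mul_meas_ge_le_integral_of_nonneg (μ := D)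
    (Filter.Eventually.of_forall fun x => Real.rpow_nonneg (abs_nonneg (x - ∫ y, y ∂D)) κ) hIk
    (w ^ κ)
  have e : {x : ℝ | w ≤ |x - ∫ y, y ∂D|} = {x | w ^ κ ≤ |x - ∫ y, y ∂D| ^ κ} := by
    ext x
    exact (Real.rpow_le_rpow_iff hw.le (abs_nonneg _) hκ).symm
  rw [le_div_iff₀ (by positivity), mul_comm, e]
  exact h.trans hle

/-- The factor 16 pays for four lost halvings: one by the floor, one explicit, and `2 / κ ≤ 2`. The
bound survives truncation of the floor at zero. Times `3/2 * lam` it becomes the radius `24 σ`. -/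
lemma inv_two_pow_grayBits_le {κ lam σ : ℝ} (hκ : 1 ≤ κ) (hσ : 0 < σ) (hlam : 0 < lam) :
    ((2 : ℝ) ^ grayBits κ lam σ)⁻¹ ≤ 16 * σ / lam := by
  have h1 := Nat.lt_floor_add_one (Real.logb 2 (lam / σ) - 1 - 2 / κ)
  have h2 : 2 / κ ≤ 2 := by
    rw [div_le_iff₀ (by linarith)]
    linarith
  have h3 : Real.logb 2 (lam / σ) ≤ ((grayBits κ lam σ + 4 : ℕ) : ℝ) := by
    unfold grayBits
    push_cast
    linarith
  rw [Real.logb_le_iff_le_rpow one_lt_two (by positivity), Real.rpow_natCast, pow_add] at h3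
  rw [inv_le_comm₀ (by positivity) (by positivity), inv_div, div_le_iff₀ (by positivity)]
  rw [div_le_iff₀ hσ] at h3
  linarith

/-- In the original scale the stability window has radius at least `σ * 2 ^ (2 / κ)`, at which
Markov's inequality gives exactly `1/4`. A positive bit count ensures that the floor was not
truncated from a negative number. -/
lemma margin_le_of_grayBits_pos {κ lam σ : ℝ} (hσ : 0 < σ) (hlam : 0 < lam)
    (hM : 0 < grayBits κ lam σ) :
    σ * 2 ^ (2 / κ) ≤ 2 * lam * ((2 : ℝ) ^ (grayBits κ lam σ + 2))⁻¹ := by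
  have h0 : 1 ≤ Real.logb 2 (lam / σ) - 1 - 2 / κ := Nat.floor_pos.1 hM
  have h1 : (grayBits κ lam σ : ℝ) ≤ Real.logb 2 (lam / σ) - 1 - 2 / κ :=
    Nat.floor_le (zero_le_one.trans h0)
  have h2 : (grayBits κ lam σ : ℝ) + 1 + 2 / κ ≤ Real.logb 2 (lam / σ) := by linarith
  rw [Real.le_logb_iff_rpow_le one_lt_two (by positivity), Real.rpow_add two_pos,
    Real.rpow_add two_pos, Real.rpow_natCast, Real.rpow_one, le_div_iff₀ hσ] at h2
  rw [← div_eq_mul_inv, le_div_iff₀ (by positivity), pow_add]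
  linarith

/-- At a level at which the Gray function is constant near the mean, a sample gives the wrong bit
with probability at most `1/4`. -/
lemma measureReal_grayFun_ne_le {κ lam σ : ℝ} (hκ : 0 < κ) (hσ : 0 < σ) (hlam : 0 < lam)
    {D : Measure ℝ} (hD : D ∈ momentFamily κ lam σ) (ℓ : Fin (grayBits κ lam σ)) {b : Bool}
    (hst : ∀ x, |x - ((∫ y, y ∂D) + lam) / (2 * lam)| < ((2 : ℝ) ^ (grayBits κ lam σ + 2))⁻¹ →
      grayFun (ℓ + 1) x = b) :
    D.real {x | (grayFun (ℓ + 1) ((x + lam) / (2 * lam)) != b) = true} ≤ 1 / 4 := by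
  have hP := hD.1
  set w := 2 * lam * ((2 : ℝ) ^ (grayBits κ lam σ + 2))⁻¹ with hw
  have hsub : {x : ℝ | (grayFun (ℓ + 1) ((x + lam) / (2 * lam)) != b) = true} ⊆
      {x | w ≤ |x - ∫ y, y ∂D|} := by
    intro x hx
    simp only [Set.mem_ofPred_eq, bne_iff_ne] at hx ⊢
    by_contra! hlt
    refine hx (hst _ ?_)
    rw [← sub_div, add_sub_add_right_eq_sub, abs_div, abs_of_pos (by positivity : 0 < 2 * lam),
      div_lt_iff₀ (by positivity), mul_comm]
    exact hlt
  have hmargin := margin_le_of_grayBits_pos hσ hlam (Fin.pos ℓ)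
  rw [← hw] at hmargin
  have hw0 : 0 < w := by positivity
  calc D.real {x | (grayFun (ℓ + 1) ((x + lam) / (2 * lam)) != b) = true}
      ≤ D.real {x | w ≤ |x - ∫ y, y ∂D|} := measureReal_mono hsub
    _ ≤ σ ^ κ / w ^ κ := measureReal_le_abs_sub_le hκ hw0 hD
    _ ≤ 1 / 4 := by
      have h1 : (σ * 2 ^ (2 / κ)) ^ κ ≤ w ^ κ :=
        Real.rpow_le_rpow (by positivity) hmargin hκ.le
      rw [Real.mul_rpow hσ.le (by positivity), ← Real.rpow_mul two_pos.le,
        div_mul_cancel₀ _ hκ.ne'] at h1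
      rw [div_le_iff₀ (by positivity)]
      norm_num at h1
      linarith

/-- The localization succeeds with probability at least `1 - δ / 2`. -/
lemma measureReal_localization_fails_le {κ lam σ δ : ℝ} (hκ : 1 ≤ κ) (hσ : 0 < σ)
    (hlam : 0 < lam) (hδ : 0 < δ) {D : Measure ℝ} (hD : D ∈ momentFamily κ lam σ) :
    (Measure.pi fun _ : Fin (grayBits κ lam σ) × Fin (graySamples (grayBits κ lam σ) δ) => D).real
      {x | 24 * σ < |localizationCenter lam (fun p =>
        grayFun (p.1 + 1) ((x p + lam) / (2 * lam))) - ∫ y, y ∂D|} ≤ δ / 2 := by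
  have hP := hD.1
  have hκ0 : 0 < κ := by linarith
  set M := grayBits κ lam σ with hM
  set J := graySamples M δ with hJ
  set m := ((∫ y, y ∂D) + lam) / (2 * lam) with hm
  set S : Fin M → Prop := fun ℓ => ∀ x, |x - m| < ((2 : ℝ) ^ (M + 2))⁻¹ →
      grayFun (ℓ + 1) x = grayFun (ℓ + 1) m
  set μ := Measure.pi fun _ : Fin M × Fin J => D
  -- Only errors at stable levels count as failures, so the union bound covers exactly the levels
  -- where the bit error rate is controlled.
  set E : Fin M → Set (Fin M × Fin J → ℝ) := fun ℓ => {x | S ℓ ∧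
    majority (fun j => grayFun (ℓ + 1) ((x (ℓ, j) + lam) / (2 * lam))) ≠ grayFun (ℓ + 1) m}
  have hE : ∀ ℓ, μ.real (E ℓ) ≤ Real.exp (-(J : ℝ) / 8) := by
    intro ℓ
    by_cases hS : S ℓ
    · have hmeas : Measurable fun x : ℝ =>
          (grayFun (ℓ + 1) ((x + lam) / (2 * lam)) != grayFun (ℓ + 1) m) :=
        (measurable_from_top (f := fun b : Bool => b != grayFun (ℓ + 1) m)).comp
          ((measurable_grayFun _).comp (by fun_prop))
      have hind : ProbabilityTheory.iIndepFun (fun (p : Fin M × Fin J) (x : Fin M × Fin J → ℝ) =>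
          (grayFun (ℓ + 1) ((x p + lam) / (2 * lam)) != grayFun (ℓ + 1) m)) μ :=
        ProbabilityTheory.iIndepFun_pi (X := fun _ x =>
          (grayFun (ℓ + 1) ((x + lam) / (2 * lam)) != grayFun (ℓ + 1) m))
          fun _ => hmeas.aemeasurable
      have hind' := hind.precomp (g := fun j : Fin J => (ℓ, j)) (Prod.mk_right_injective ℓ)
      refine (measureReal_mono ?_).trans (measureReal_half_le_card_le_exp
        (fun j => hmeas.comp (measurable_pi_apply (ℓ, j))) hind' fun j => ?_)
      · intro x hx
        exact half_le_card_of_majority_ne hx.2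
      · have hset : MeasurableSet {x : ℝ |
            (grayFun (ℓ + 1) ((x + lam) / (2 * lam)) != grayFun (ℓ + 1) m) = true} :=
          hmeas (measurableSet_singleton true)
        have := (measurePreserving_eval (fun _ : Fin M × Fin J => D) (ℓ, j)).measureReal_preimage
          hset.nullMeasurableSet
        refine (le_of_eq this).trans ?_
        exact measureReal_grayFun_ne_le hκ0 hσ hlam hD ℓ hS
    · have : E ℓ = ∅ := by
        ext x
        simp [E, hS]
      rw [this]
      simp [Real.exp_nonneg]
  have hsub : {x : Fin M × Fin J → ℝ | 24 * σ < |localizationCenter lam (fun p =>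
      grayFun (p.1 + 1) ((x p + lam) / (2 * lam))) - ∫ y, y ∂D|} ⊆ ⋃ ℓ, E ℓ := by
    intro x hx
    by_contra hcon
    simp only [Set.mem_iUnion, not_exists] at hcon
    have h1 := abs_localizationCenter_sub_le hlam hD.2.2.1 (M := M) (J := J)
      (y := fun p => grayFun (p.1 + 1) ((x p + lam) / (2 * lam))) (by
        intro ℓ hℓ
        by_contra hne
        exact hcon ℓ ⟨hℓ, hne⟩)
    have h2 := inv_two_pow_grayBits_le hκ hσ hlam
    have h3 : 3 / 2 * lam * ((2 : ℝ) ^ M)⁻¹ ≤ 3 / 2 * lam * (16 * σ / lam) := by gcongr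
    have h4 : 3 / 2 * lam * (16 * σ / lam) = 24 * σ := by
      field_simp
      norm_num
    simp only [Set.mem_ofPred_eq] at hx
    linarith
  calc _ ≤ μ.real (⋃ ℓ, E ℓ) := measureReal_mono hsub
    _ ≤ ∑ ℓ, μ.real (E ℓ) := measureReal_iUnion_fintype_le _
    _ ≤ ∑ _ℓ : Fin M, Real.exp (-(J : ℝ) / 8) := Finset.sum_le_sum fun ℓ _ => hE ℓ
    _ = M * Real.exp (-(J : ℝ) / 8) := by simp
    _ ≤ δ / 2 := by
      rcases Nat.eq_zero_or_pos M with h | h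
      · rw [h]
        simp only [Nat.cast_zero, zero_mul]
        positivity
      · have hM0 : (0 : ℝ) < M := by exact_mod_cast h
        have h1 : 8 * Real.log (2 * M / δ) ≤ J := Nat.le_ceil _
        have h2 : Real.exp (-(J : ℝ) / 8) ≤ Real.exp (-Real.log (2 * M / δ)) := by
          apply Real.exp_le_exp.2
          linarith
        rw [Real.exp_neg, Real.exp_log (by positivity), inv_div] at h2
        calc (M : ℝ) * Real.exp (-(J : ℝ) / 8) ≤ M * (δ / (2 * M)) := by gcongr
          _ = δ / 2 := by field_simp

/-! ### Mean and variance of a base estimate for a fixed centre. -/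

/-- The indicator of a positive answer to a query of kind `q` on the region with endpoints `a, b`
and sign `s`, as a function of the uniform variable and the sample. -/
noncomputable def hitIndicator (q : Fin 4) (a b s c : ℝ) (p : unitInterval × ℝ) : ℝ :=
  if queryThreshold q a b p.1 ≤ s * (p.2 - c) then 1 else 0

/-- The weight of the queries of kind `q` in the base estimate. -/
noncomputable def queryWeight (a b : ℝ) : Fin 4 → ℝ := ![a, -a, -b, b]

/-- The identity truncated to `[0, t)`. -/
noncomputable def truncBelow (t y : ℝ) : ℝ := if 0 ≤ y ∧ y < t then y else 0

lemma measurableSet_hit (q : Fin 4) (a b s c : ℝ) :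
    MeasurableSet {p : unitInterval × ℝ | queryThreshold q a b p.1 ≤ s * (p.2 - c)} :=
  measurableSet_le ((measurable_queryThreshold q a b).comp
    (measurable_subtype_coe.comp measurable_fst)) (by fun_prop)

lemma measurable_hitIndicator (q : Fin 4) (a b s c : ℝ) : Measurable (hitIndicator q a b s c) :=
  Measurable.ite (measurableSet_hit q a b s c) measurable_const measurable_const

lemma hitIndicator_mem_Icc (q : Fin 4) (a b s c : ℝ) (p : unitInterval × ℝ) :
    hitIndicator q a b s c p ∈ Set.Icc (0 : ℝ) 1 := by
  unfold hitIndicator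
  split_ifs <;> simp

lemma memLp_hitIndicator (q : Fin 4) (a b s c : ℝ) (μ : Measure (unitInterval × ℝ))
    [IsFiniteMeasure μ] (r : ENNReal) : MemLp (hitIndicator q a b s c) r μ :=
  MemLp.of_bound (measurable_hitIndicator q a b s c).aestronglyMeasurable 1
    (Filter.Eventually.of_forall fun p => by
      have := hitIndicator_mem_Icc q a b s c p
      rw [Real.norm_of_nonneg this.1]
      exact this.2)

lemma measurable_truncBelow (t : ℝ) : Measurable (truncBelow t) :=
  Measurable.ite ((measurableSet_le measurable_const measurable_id).inter
    (measurableSet_lt measurable_id measurable_const)) measurable_id measurable_const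

lemma abs_truncBelow_le (t y : ℝ) : |truncBelow t y| ≤ |t| := by
  unfold truncBelow
  split_ifs with h
  · rw [abs_of_nonneg h.1]
    exact h.2.le.trans (le_abs_self t)
  · simp

lemma integrable_truncBelow (t s c : ℝ) (D : Measure ℝ) [IsFiniteMeasure D] :
    Integrable (fun x => truncBelow t (s * (x - c))) D :=
  Integrable.of_bound ((measurable_truncBelow t).comp (by fun_prop)).aestronglyMeasurable |t|
    (Filter.Eventually.of_forall fun x => abs_truncBelow_le t _)

lemma volume_real_unitInterval_le (z : ℝ) :
    (volume : Measure unitInterval).real {u | (u : ℝ) ≤ z} = max 0 (min 1 z) := by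
  rcases lt_or_ge z 0 with h | h
  · have : {u : unitInterval | (u : ℝ) ≤ z} = ∅ := by
      ext u
      simp only [Set.mem_ofPred_eq, Set.mem_empty_iff_false, iff_false, not_le]
      exact h.trans_le u.2.1
    rw [this, measureReal_empty, min_eq_right (by linarith), max_eq_left h.le]
  · rcases le_or_gt z 1 with h1 | h1
    · have : {u : unitInterval | (u : ℝ) ≤ z} = Set.Iic ⟨z, h, h1⟩ := by
        ext u
        exact Iff.rfl
      rw [this, Measure.real, unitInterval.volume_Iic, ENNReal.toReal_ofReal h,
        clamp_eq_self ⟨h, h1⟩]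
    · have : {u : unitInterval | (u : ℝ) ≤ z} = Set.univ := by
        ext u
        simp only [Set.mem_ofPred_eq, Set.mem_univ, iff_true]
        exact u.2.2.trans h1.le
      rw [this, probReal_univ, min_eq_left h1.le, max_eq_right zero_le_one]

/-- Averaging over the random thresholds: the weighted sum of the four kinds of answers is an
unbiased estimate of the part of `y` in `[a, b)`. -/
lemma sum_queryWeight_mul_integral {a b : ℝ} (ha : 0 ≤ a) (hab : a < b) (y : ℝ) :
    ∑ q, queryWeight a b q *
      ∫ u : unitInterval, (if queryThreshold q a b u ≤ y then (1 : ℝ) else 0) =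
      truncBelow b y - truncBelow a y := by
  have hba : 0 < b - a := sub_pos.2 hab
  have hT : ∫ u : unitInterval, (if a + (b - a) * (u : ℝ) ≤ y then (1 : ℝ) else 0) =
      max 0 (min 1 ((y - a) / (b - a))) := by
    rw [← volume_real_unitInterval_le, ← integral_indicator_one]
    · refine integral_congr_ae (Filter.Eventually.of_forall fun u => ?_)
      simp only [Set.indicator_apply, Set.mem_ofPred_eq, Pi.one_apply]
      congr 1
      rw [le_div_iff₀ hba, eq_iff_iff]
      constructor <;> intro h <;> linarith
    · exact measurableSet_le measurable_subtype_coe measurable_const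
  have e0 : ∀ u : unitInterval, queryThreshold 0 a b u = a := fun u => by simp [queryThreshold]
  have e1 : ∀ u : unitInterval, queryThreshold 1 a b u = a + (b - a) * u := fun u => by
    simp [queryThreshold]
  have e2 : ∀ u : unitInterval, queryThreshold 2 a b u = b := fun u => by simp [queryThreshold]
  have e3 : ∀ u : unitInterval, queryThreshold 3 a b u = a + (b - a) * u := fun u => by
    simp [queryThreshold]
  simp only [Fin.sum_univ_four, e0, e1, e2, e3, hT, integral_const, probReal_univ, one_smul]
  simp only [queryWeight, Matrix.cons_val]
  -- With `p = P(T ≤ y)` the left side is `a 1{a ≤ y} + (b - a) p - b 1{b ≤ y}`: zero below `a`, `a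
  -- + (y - a) = y` on `[a, b)`, and `a + (b - a) - b = 0` from `b` on.
  unfold truncBelow
  rcases lt_or_ge y a with h1 | h1
  · have h2 : (y - a) / (b - a) ≤ 0 := div_nonpos_of_nonpos_of_nonneg (by linarith) hba.le
    rw [max_eq_left ((min_le_right _ _).trans h2), if_neg (by linarith), if_neg (by linarith)]
    have : (0 ≤ y ∧ y < b) ↔ (0 ≤ y ∧ y < a) := by
      constructor <;> rintro ⟨h3, h4⟩ <;> exact ⟨h3, by linarith⟩
    simp only [this]
    ring
  · rcases lt_or_ge y b with h2 | h2
    · have h3 : (y - a) / (b - a) ∈ Set.Icc (0 : ℝ) 1 :=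
        ⟨div_nonneg (by linarith) hba.le, by rw [div_le_one hba]; linarith⟩
      rw [clamp_eq_self h3, if_pos h1, if_neg (by linarith), if_pos ⟨by linarith, h2⟩,
        if_neg (by intro h; linarith [h.2])]
      field_simp
      ring
    · have h3 : 1 ≤ (y - a) / (b - a) := by rw [one_le_div hba]; linarith
      rw [min_eq_left h3, max_eq_right zero_le_one, if_pos h1, if_pos h2,
        if_neg (by intro h; linarith [h.2]), if_neg (by intro h; linarith [h.2])]
      ring

lemma sum_queryWeight_mul_integral_prod {a b : ℝ} (ha : 0 ≤ a) (hab : a < b) (s c : ℝ)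
    (D : Measure ℝ) [IsProbabilityMeasure D] :
    ∑ q, queryWeight a b q *
      ∫ p, hitIndicator q a b s c p ∂((volume : Measure unitInterval).prod D) =
      (∫ x, truncBelow b (s * (x - c)) ∂D) - ∫ x, truncBelow a (s * (x - c)) ∂D := by
  have hint : ∀ q, Integrable (hitIndicator q a b s c)
      ((volume : Measure unitInterval).prod D) := fun q =>
    memLp_one_iff_integrable.1 (memLp_hitIndicator q a b s c _ 1)
  rw [← integral_sub (integrable_truncBelow _ _ _ _) (integrable_truncBelow _ _ _ _)]
  simp_rw [← sum_queryWeight_mul_integral ha hab]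
  rw [integral_finsetSum]
  · refine Finset.sum_congr rfl fun q _ => ?_
    rw [integral_const_mul, integral_prod_symm _ (hint q)]
    rfl
  · exact fun q _ => (hint q).integral_prod_right.const_mul _

lemma sq_queryWeight_le {a b : ℝ} (ha : 0 ≤ a) (hab : a ≤ b) (q : Fin 4) :
    queryWeight a b q ^ 2 ≤ b ^ 2 := by
  fin_cases q <;> simp [queryWeight] <;> nlinarith

/-- Every query on a region is positive only beyond its inner endpoint. -/
lemma hitIndicator_le {a b : ℝ} (hab : a ≤ b) (q : Fin 4) (s c : ℝ) (p : unitInterval × ℝ) :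
    hitIndicator q a b s c p ≤ if a ≤ s * (p.2 - c) then 1 else 0 := by
  have h : a ≤ queryThreshold q a b p.1 := by
    unfold queryThreshold
    split_ifs
    · exact le_rfl
    · exact hab
    · have := mul_nonneg (sub_nonneg.2 hab) p.1.2.1
      linarith
  unfold hitIndicator
  split_ifs with h1 h2 h2
  · exact le_rfl
  · exact absurd (h.trans h1) h2
  · exact zero_le_one
  · exact le_rfl

lemma integral_sq_hitIndicator_le {a b : ℝ} (hab : a ≤ b) (q : Fin 4) (s c : ℝ)
    (D : Measure ℝ) [IsProbabilityMeasure D] :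
    ∫ p, hitIndicator q a b s c p ^ 2 ∂((volume : Measure unitInterval).prod D) ≤
      ∫ x, (if a ≤ s * (x - c) then 1 else 0) ∂D := by
  have hm : Measurable fun x : ℝ => if a ≤ s * (x - c) then (1 : ℝ) else 0 :=
    Measurable.ite (measurableSet_le measurable_const (by fun_prop)) measurable_const
      measurable_const
  have hI : Integrable (fun x : ℝ => if a ≤ s * (x - c) then (1 : ℝ) else 0) D :=
    Integrable.of_bound hm.aestronglyMeasurable 1
      (Filter.Eventually.of_forall fun x => by split_ifs <;> simp)
  have h2 : ∫ p : unitInterval × ℝ, (if a ≤ s * (p.2 - c) then (1 : ℝ) else 0)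
      ∂((volume : Measure unitInterval).prod D) = ∫ x, (if a ≤ s * (x - c) then 1 else 0) ∂D := by
    have := integral_fun_snd (μ := (volume : Measure unitInterval)) (ν := D)
      fun x : ℝ => if a ≤ s * (x - c) then (1 : ℝ) else 0
    simpa using this
  rw [← h2]
  refine integral_mono (memLp_hitIndicator q a b s c _ 2).integrable_sq (hI.comp_snd _) fun p => ?_
  have h3 := hitIndicator_mem_Icc q a b s c p
  refine le_trans ?_ (hitIndicator_le hab q s c p)
  show hitIndicator q a b s c p ^ 2 ≤ hitIndicator q a b s c p
  nlinarith [h3.1, h3.2]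

lemma gridPoint_succ (i : ℕ) : gridPoint (i + 1) = 2 ^ (i + 1) := by simp [gridPoint]

lemma gridPoint_nonneg (i : ℕ) : 0 ≤ gridPoint i := by
  unfold gridPoint
  split_ifs <;> positivity

lemma gridPoint_lt_succ (i : ℕ) : gridPoint i < gridPoint (i + 1) := by
  rw [gridPoint_succ]
  unfold gridPoint
  split_ifs
  · positivity
  · exact pow_lt_pow_right₀ one_lt_two (Nat.lt_succ_self i)

lemma sq_signOf (b : Bool) : signOf b ^ 2 = 1 := by
  cases b <;> simp [signOf]

/-- The contribution of a single slot to a base estimate. -/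
noncomputable def slotTerm (σ c : ℝ) {N : ℕ} (n : ℕ → ℕ) (s : Σ i : Fin N, Bool × Fin 4 × Fin (n i))
    (p : unitInterval × ℝ) : ℝ :=
  signOf s.2.1 * queryWeight (σ * gridPoint s.1) (σ * gridPoint (s.1 + 1)) s.2.2.1 / n s.1 *
    hitIndicator s.2.2.1 (σ * gridPoint s.1) (σ * gridPoint (s.1 + 1)) (signOf s.2.1) c p

lemma bitMean_eq_sum {n : ℕ} (v : Fin n → Bool) :
    bitMean v = (∑ m, if v m = true then (1 : ℝ) else 0) / n := by
  simp [bitMean]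

lemma sum_slot {N : ℕ} {n : ℕ → ℕ} (f : (Σ i : Fin N, Bool × Fin 4 × Fin (n i)) → ℝ) :
    ∑ s, f s = ∑ i : Fin N, ∑ b : Bool, ∑ q : Fin 4, ∑ m : Fin (n i), f ⟨i, b, q, m⟩ := by
  rw [Fintype.sum_sigma]
  refine Finset.sum_congr rfl fun i _ => ?_
  rw [Fintype.sum_prod_type]
  refine Finset.sum_congr rfl fun b _ => ?_
  rw [Fintype.sum_prod_type]

lemma baseEstimate_eq_sum {cT cN κ σ ε δ : ℝ} (c : ℝ)
    (w : RefinementSlot cT cN κ σ ε δ → unitInterval × ℝ) (j : Fin (numBatches δ)) :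
    baseEstimate (fun r => refinementQuery c r (w r).1 (w r).2) j =
      ∑ s, slotTerm σ c (fun i => regionSamples cN κ σ ε (i + 1)) s (w (j, s)) := by
  refine Eq.trans ?_ (sum_slot (n := fun i => regionSamples cN κ σ ε (i + 1)) _).symm
  unfold baseEstimate
  refine Finset.sum_congr rfl fun i _ => Finset.sum_congr rfl fun b _ => ?_
  simp only [bitMean_eq_sum, slotTerm, Fin.sum_univ_four, ← Finset.mul_sum, refinementQuery,
    hitIndicator, decide_eq_true_eq]
  simp only [queryWeight, Matrix.cons_val]
  ring

lemma memLp_slotTerm (σ c : ℝ) {N : ℕ} (n : ℕ → ℕ) (s : Σ i : Fin N, Bool × Fin 4 × Fin (n i))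
    (ν : Measure (unitInterval × ℝ)) [IsFiniteMeasure ν] (r : ENNReal) :
    MemLp (slotTerm σ c n s) r ν :=
  (memLp_hitIndicator _ _ _ _ _ ν r).const_mul _

/-- The mean of a base estimate is the mean of the recentred law truncated to the union of the
regions. -/
lemma sum_integral_slotTerm {σ : ℝ} (hσ : 0 < σ) (c : ℝ) {N : ℕ} {n : ℕ → ℕ} (hn : ∀ i, 0 < n i)
    (D : Measure ℝ) [IsProbabilityMeasure D] :
    ∑ s : Σ i : Fin N, Bool × Fin 4 × Fin (n i),
      ∫ p, slotTerm σ c n s p ∂((volume : Measure unitInterval).prod D) =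
    ∫ x, (truncBelow (σ * gridPoint N) (x - c) - truncBelow (σ * gridPoint N) (-(x - c))) ∂D := by
  set F : Bool → ℕ → ℝ := fun b i => ∫ x, truncBelow (σ * gridPoint i) (signOf b * (x - c)) ∂D
    with hF
  have h1 : ∀ (i : Fin N) (b : Bool), ∑ q : Fin 4, ∑ m : Fin (n i),
      ∫ p, slotTerm σ c n ⟨i, b, q, m⟩ p ∂((volume : Measure unitInterval).prod D) =
      signOf b * (F b (i + 1) - F b i) := by
    intro i b
    have hn0 : (n i : ℝ) ≠ 0 := by exact_mod_cast (hn i).ne'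
    rw [hF, ← sum_queryWeight_mul_integral_prod (mul_nonneg hσ.le (gridPoint_nonneg i))
      (mul_lt_mul_of_pos_left (gridPoint_lt_succ i) hσ), Finset.mul_sum]
    refine Finset.sum_congr rfl fun q _ => ?_
    simp only [slotTerm, integral_const_mul, Finset.sum_const, Finset.card_univ, Fintype.card_fin,
      nsmul_eq_mul]
    field_simp
  rw [sum_slot]
  simp only [h1]
  rw [Finset.sum_comm]
  simp only [← Finset.mul_sum]
  -- Adjacent regions share an endpoint, so the truncations telescope. The innermost term vanishes
  -- because the grid starts at 0.
  have h2 : ∀ b, ∑ i : Fin N, (F b (i + 1) - F b i) = F b N := by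
    intro b
    rw [Fin.sum_univ_eq_sum_range (fun i => F b (i + 1) - F b i) N, Finset.sum_range_sub]
    have : F b 0 = 0 := by
      simp only [hF, gridPoint, if_true, mul_zero]
      have : ∀ y, truncBelow 0 y = 0 := by
        intro y
        unfold truncBelow
        rw [if_neg]
        rintro ⟨h3, h4⟩
        linarith
      simp [this]
    rw [this, sub_zero]
  simp only [h2, Fintype.sum_bool]
  rw [integral_sub]
  · simp [hF, signOf, sub_eq_add_neg]
  · simpa using integrable_truncBelow (σ * gridPoint N) 1 c D
  · simpa using integrable_truncBelow (σ * gridPoint N) (-1) c D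

/-- The variance is at most the second moment; the weights are at most the outer endpoint, and a
positive answer forces the sample beyond the inner one. The factor 4 counts the kinds of queries. -/
lemma sum_variance_slotTerm_le {σ : ℝ} (hσ : 0 < σ) (c : ℝ) {N : ℕ} {n : ℕ → ℕ}
    (hn : ∀ i, 0 < n i) (D : Measure ℝ) [IsProbabilityMeasure D] :
    ∑ s : Σ i : Fin N, Bool × Fin 4 × Fin (n i),
      ProbabilityTheory.variance (slotTerm σ c n s) ((volume : Measure unitInterval).prod D) ≤
    ∑ i : Fin N, ∑ b : Bool, 4 * ((σ * gridPoint (i + 1)) ^ 2 / n i) *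
      ∫ x, (if σ * gridPoint i ≤ signOf b * (x - c) then 1 else 0) ∂D := by
  rw [sum_slot]
  refine Finset.sum_le_sum fun i _ => Finset.sum_le_sum fun b _ => ?_
  have hn0 : (0 : ℝ) < n i := by exact_mod_cast hn i
  have ha := mul_nonneg hσ.le (gridPoint_nonneg i)
  have hab := (mul_lt_mul_of_pos_left (gridPoint_lt_succ i) hσ).le
  set P := ∫ x, (if σ * gridPoint i ≤ signOf b * (x - c) then (1 : ℝ) else 0) ∂D with hP
  have hP0 : 0 ≤ P := integral_nonneg fun x => by
    show (0 : ℝ) ≤ ite _ _ _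
    split_ifs <;> norm_num
  have hterm : ∀ (q : Fin 4) (m : Fin (n i)), ProbabilityTheory.variance
      (slotTerm σ c n (⟨i, b, q, m⟩ : Σ i : Fin N, Bool × Fin 4 × Fin (n i)))
      ((volume : Measure unitInterval).prod D) ≤ (σ * gridPoint (i + 1)) ^ 2 / n i ^ 2 * P := by
    intro q m
    refine (ProbabilityTheory.variance_le_expectation_sq
      (memLp_slotTerm σ c n _ _ 2).aestronglyMeasurable).trans ?_
    simp only [slotTerm, Pi.pow_apply, mul_pow, div_pow, sq_signOf, one_mul]
    rw [integral_const_mul]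
    have h1 := sq_queryWeight_le ha hab q
    have h2 := integral_sq_hitIndicator_le hab q (signOf b) c D
    rw [← mul_pow]
    gcongr
  calc _ ≤ ∑ _q : Fin 4, ∑ _m : Fin (n i), (σ * gridPoint (i + 1)) ^ 2 / n i ^ 2 * P :=
        Finset.sum_le_sum fun q _ => Finset.sum_le_sum fun m _ => hterm q m
    _ = 4 * ((σ * gridPoint (i + 1)) ^ 2 / n i) * P := by
      simp
      field_simp

/-! ### Bias, variance and the choice of constants. -/

/-- The moments of the law recentred near its mean are bounded up to an absolute constant. -/
lemma recentred_moment_le {κ lam σ c : ℝ} (hκ : 1 < κ) (hκ3 : κ ≤ 3) (hσ : 0 < σ) {D : Measure ℝ}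
    (hD : D ∈ momentFamily κ lam σ) (hc : |c - ∫ y, y ∂D| ≤ 24 * σ) :
    Integrable (fun x => |x - c| ^ κ) D ∧ ∫ x, |x - c| ^ κ ∂D ≤ 110600 * σ ^ κ := by
  obtain ⟨hP, hI, hm, hIk, hle⟩ := hD
  set μ := ∫ y, y ∂D
  have hκ0 : 0 < κ := by linarith
  -- The cap `κ ≤ 3` enters here: it bounds `2 ^ κ` and `24 ^ κ` absolutely, and `8 * (1 + 13824) =
  -- 110600`.
  have h8 : (2 : ℝ) ^ κ ≤ 8 := by
    calc (2 : ℝ) ^ κ ≤ 2 ^ (3 : ℝ) := Real.rpow_le_rpow_of_exponent_le one_le_two hκ3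
      _ = 8 := by norm_num
  have h24 : (24 : ℝ) ^ κ ≤ 13824 := by
    calc (24 : ℝ) ^ κ ≤ 24 ^ (3 : ℝ) := Real.rpow_le_rpow_of_exponent_le (by norm_num) hκ3
      _ = 13824 := by norm_num
  have hpt : ∀ x, |x - c| ^ κ ≤ 8 * (|x - μ| ^ κ + 13824 * σ ^ κ) := by
    intro x
    have h1 : |x - c| ≤ |x - μ| + 24 * σ := by
      have := abs_sub_le x μ c
      rw [abs_sub_comm μ c] at this
      linarith
    have h2 : |x - c| ≤ 2 * max |x - μ| (24 * σ) := by
      linarith [le_max_left |x - μ| (24 * σ), le_max_right |x - μ| (24 * σ)]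
    have h0 : 0 ≤ |x - μ| ^ κ := by positivity
    have h3 : (max |x - μ| (24 * σ)) ^ κ ≤ |x - μ| ^ κ + 13824 * σ ^ κ := by
      rcases max_cases |x - μ| (24 * σ) with ⟨h, _⟩ | ⟨h, _⟩ <;> rw [h]
      · have : 0 ≤ σ ^ κ := by positivity
        linarith
      · rw [Real.mul_rpow (by norm_num) hσ.le]
        have : 24 ^ κ * σ ^ κ ≤ 13824 * σ ^ κ := by gcongr
        linarith
    calc |x - c| ^ κ ≤ (2 * max |x - μ| (24 * σ)) ^ κ :=
          Real.rpow_le_rpow (abs_nonneg _) h2 hκ0.le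
      _ = 2 ^ κ * (max |x - μ| (24 * σ)) ^ κ :=
          Real.mul_rpow two_pos.le (le_max_of_le_left (abs_nonneg _))
      _ ≤ 8 * (|x - μ| ^ κ + 13824 * σ ^ κ) := by gcongr
  have hbd : Integrable (fun x => 8 * (|x - μ| ^ κ + 13824 * σ ^ κ)) D :=
    (hIk.add (integrable_const _)).const_mul _
  have hint : Integrable (fun x => |x - c| ^ κ) D := by
    refine hbd.mono' (Measurable.aestronglyMeasurable (by fun_prop))
      (Filter.Eventually.of_forall fun x => ?_)
    rw [Real.norm_of_nonneg (by positivity)]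
    exact hpt x
  refine ⟨hint, (integral_mono hint hbd hpt).trans ?_⟩
  rw [integral_const_mul, integral_add hIk (integrable_const _)]
  simp only [integral_const, probReal_univ, one_smul]
  linarith

/-- The bias due to the truncation. -/
lemma abs_integral_trunc_sub_le {κ B c : ℝ} (hκ : 1 < κ) (hB : 0 < B) {D : Measure ℝ}
    [IsProbabilityMeasure D] (hI : Integrable (fun x : ℝ => x) D)
    (hIk : Integrable (fun x => |x - c| ^ κ) D) :
    |(∫ x, (truncBelow B (x - c) - truncBelow B (-(x - c))) ∂D) - ((∫ x, x ∂D) - c)| ≤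
      (∫ x, |x - c| ^ κ ∂D) / B ^ (κ - 1) := by
  have h1 : Integrable (fun x => truncBelow B (x - c) - truncBelow B (-(x - c))) D := by
    refine Integrable.sub ?_ ?_
    · simpa using integrable_truncBelow B 1 c D
    · simpa using integrable_truncBelow B (-1) c D
  have h2 : (∫ x, x ∂D) - c = ∫ x, (x - c) ∂D := by
    rw [integral_sub hI (integrable_const _)]
    simp
  have h3 : Integrable (fun x => x - c) D := hI.sub (integrable_const _)
  rw [h2, ← integral_sub h1 h3, ← integral_div,
    ← Real.norm_eq_abs]
  refine norm_integral_le_of_norm_le (hIk.div_const _) (Filter.Eventually.of_forall fun x => ?_)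
  rw [Real.norm_eq_abs]
  generalize x - c = y
  have hnn : 0 ≤ |y| ^ κ / B ^ (κ - 1) := by positivity
  -- Truncation is exact for `|y| < B`. Otherwise the error is `|y|`, which is at most `|y| ^ κ / B
  -- ^ (κ - 1)`.
  rcases lt_or_ge |y| B with h | h
  · have e : truncBelow B y - truncBelow B (-y) - y = 0 := by
      rw [abs_lt] at h
      unfold truncBelow
      rcases lt_trichotomy y 0 with hy | hy | hy
      · rw [if_neg (by intro h'; linarith [h'.1]), if_pos ⟨by linarith, by linarith⟩]
        ring
      · subst hy
        simp
      · rw [if_pos ⟨hy.le, h.2⟩, if_neg (by intro h'; linarith [h'.1])]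
        ring
    rw [e, abs_zero]
    exact hnn
  · have e : truncBelow B y - truncBelow B (-y) - y = -y := by
      unfold truncBelow
      rw [if_neg, if_neg]
      · ring
      · rintro ⟨h3, h4⟩
        rw [abs_of_nonpos (by linarith)] at h
        linarith
      · rintro ⟨h3, h4⟩
        rw [abs_of_nonneg h3] at h
        linarith
    rw [e, abs_neg, le_div_iff₀ (by positivity)]
    have hy : 0 < |y| := hB.trans_le h
    calc |y| * B ^ (κ - 1) ≤ |y| * |y| ^ (κ - 1) := by
          gcongr
      _ = |y| ^ κ := by
          rw [Real.rpow_sub hy, Real.rpow_one]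
          field_simp

lemma geom_sum_le_two_mul {q : ℝ} (hq : 2 ≤ q) (N : ℕ) :
    ∑ i ∈ Finset.range (N + 1), q ^ i ≤ 2 * q ^ N := by
  induction N with
  | zero => simp
  | succ N ih =>
    rw [Finset.sum_range_succ]
    have : 0 ≤ q ^ N := by positivity
    have e : q ^ (N + 1) = q ^ N * q := pow_succ q N
    nlinarith

/-- A point lies in few outer regions: the weighted count of the grid points below it is bounded
by its `κ`-th power. -/
lemma sum_grid_indicator_le {κ : ℝ} (hκ : 1 ≤ κ) (N : ℕ) (v : ℝ) :
    ∑ i ∈ Finset.range N, ((2 : ℝ) ^ κ) ^ i * (if gridPoint i ≤ v then 1 else 0) ≤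
      1 + 2 * |v| ^ κ := by
  have hq : (2 : ℝ) ≤ 2 ^ κ := by
    simpa using Real.rpow_le_rpow_of_exponent_le one_le_two hκ
  have hv : 0 ≤ |v| ^ κ := by positivity
  induction N with
  | zero =>
    simp only [Finset.range_zero, Finset.sum_empty]
    linarith
  | succ N ih =>
    rcases N with _ | N
    · simp only [zero_add, Finset.range_one, Finset.sum_singleton, pow_zero, one_mul]
      split_ifs <;> linarith
    -- If the last grid point is below `v`, the last term dominates the geometric sum and is at most
    -- `|v| ^ κ`; otherwise it vanishes. The summand 1 in the bound pays for the index 0.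
    · by_cases h : gridPoint (N + 1) ≤ v
      · calc ∑ i ∈ Finset.range (N + 1 + 1), ((2 : ℝ) ^ κ) ^ i * (if gridPoint i ≤ v then 1 else 0)
            ≤ ∑ i ∈ Finset.range (N + 1 + 1), ((2 : ℝ) ^ κ) ^ i := by
              refine Finset.sum_le_sum fun i _ => mul_le_of_le_one_right (by positivity) ?_
              split_ifs <;> norm_num
          _ ≤ 2 * ((2 : ℝ) ^ κ) ^ (N + 1) := geom_sum_le_two_mul hq _
          _ = 2 * ((2 : ℝ) ^ (N + 1)) ^ κ := by
              rw [← Real.rpow_natCast, ← Real.rpow_natCast, ← Real.rpow_mul two_pos.le,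
                ← Real.rpow_mul two_pos.le, mul_comm κ]
          _ ≤ 2 * |v| ^ κ := by
              rw [gridPoint_succ] at h
              have : (2 : ℝ) ^ (N + 1) ≤ |v| := h.trans (le_abs_self v)
              gcongr
          _ ≤ 1 + 2 * |v| ^ κ := by linarith
      · rw [Finset.sum_range_succ, if_neg h, mul_zero, add_zero]
        exact ih

/-- The constant in the cutoff of the refinement, for moments of order `κ`. -/
noncomputable def cutoffConst (κ : ℝ) : ℝ := 221200 ^ (1 / (κ - 1))

/-- The constant in the sample allocation of the refinement. -/
noncomputable def allocationConst : ℝ := 10 ^ 9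

lemma one_lt_cutoffConst {κ : ℝ} (hκ : 1 < κ) : 1 < cutoffConst κ :=
  Real.one_lt_rpow (by norm_num) (by rw [one_div]; exact inv_pos.2 (by linarith))

lemma one_lt_cutoff {κ σ ε : ℝ} (hκ : 1 < κ) (hε : 0 < ε) (hεσ : ε ≤ σ) :
    1 < cutoffConst κ * (σ / ε) ^ (1 / (κ - 1)) := by
  have h1 : 1 ≤ (σ / ε) ^ (1 / (κ - 1)) :=
    Real.one_le_rpow ((one_le_div hε).2 hεσ) (by rw [one_div]; exact inv_nonneg.2 (by linarith))
  nlinarith [one_lt_cutoffConst hκ]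

lemma cutoff_le_gridPoint {κ σ ε : ℝ} (hκ : 1 < κ) (hε : 0 < ε) (hεσ : ε ≤ σ) :
    cutoffConst κ * (σ / ε) ^ (1 / (κ - 1)) ≤
      gridPoint (numRegions (cutoffConst κ) κ σ ε) := by
  have h0 := one_lt_cutoff hκ hε hεσ
  have h1 : Real.logb 2 (cutoffConst κ * (σ / ε) ^ (1 / (κ - 1))) ≤
      numRegions (cutoffConst κ) κ σ ε := Nat.le_ceil _
  -- At least one region is needed, since `gridPoint 0` is 0 and not `2 ^ 0`.
  have h2 : 0 < numRegions (cutoffConst κ) κ σ ε :=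
    Nat.ceil_pos.2 (Real.logb_pos one_lt_two h0)
  rw [Real.logb_le_iff_le_rpow one_lt_two (by linarith), Real.rpow_natCast] at h1
  unfold gridPoint
  rwa [if_neg h2.ne']

lemma bias_le {κ lam σ ε c : ℝ} (hκ : 1 < κ) (hκ3 : κ ≤ 3) (hε : 0 < ε) (hεσ : ε ≤ σ)
    {D : Measure ℝ} (hD : D ∈ momentFamily κ lam σ) (hc : |c - ∫ y, y ∂D| ≤ 24 * σ) :
    |(∫ x, (truncBelow (σ * gridPoint (numRegions (cutoffConst κ) κ σ ε)) (x - c) -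
        truncBelow (σ * gridPoint (numRegions (cutoffConst κ) κ σ ε)) (-(x - c))) ∂D) -
      ((∫ x, x ∂D) - c)| ≤ ε / 2 := by
  have hσ : 0 < σ := hε.trans_le hεσ
  have hP := hD.1
  have hκ1 : 0 < κ - 1 := by linarith
  obtain ⟨hint, hmom⟩ := recentred_moment_le hκ hκ3 hσ hD hc
  have hg := cutoff_le_gridPoint hκ hε hεσ
  have h0 := one_lt_cutoff hκ hε hεσ
  set g := gridPoint (numRegions (cutoffConst κ) κ σ ε)
  have hB : 0 < σ * g := mul_pos hσ (by linarith)
  refine (abs_integral_trunc_sub_le hκ hB hD.2.1 hint).trans ?_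
  -- Here `221200 = 2 * 110600`: twice the recentred moment constant, which leaves a bias of at most
  -- `ε / 2`.
  have h1 : 221200 * (σ / ε) ≤ g ^ (κ - 1) := by
    have h2 := Real.rpow_le_rpow (by linarith) hg hκ1.le
    have h3 : 0 ≤ σ / ε := by positivity
    rw [Real.mul_rpow (by linarith [one_lt_cutoffConst hκ]) (by positivity), cutoffConst,
      ← Real.rpow_mul (by norm_num), ← Real.rpow_mul h3, one_div, inv_mul_cancel₀ hκ1.ne',
      Real.rpow_one, Real.rpow_one] at h2
    exact h2
  rw [div_le_iff₀ (by positivity), Real.mul_rpow hσ.le (by linarith)]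
  calc ∫ x, |x - c| ^ κ ∂D ≤ 110600 * σ ^ κ := hmom
    _ = ε / 2 * (σ ^ (κ - 1) * (221200 * (σ / ε))) := by
        rw [Real.rpow_sub hσ, Real.rpow_one]
        field_simp
        norm_num
    _ ≤ ε / 2 * (σ ^ (κ - 1) * g ^ (κ - 1)) := by gcongr

lemma regionSamples_pos {cN κ σ ε : ℝ} (hcN : 0 < cN) (hσ : 0 < σ) (hε : 0 < ε) (i : ℕ) :
    0 < regionSamples cN κ σ ε i := Nat.ceil_pos.2 (by positivity)

/-- This is what dictates the allocation: the weight left in front of the tail probability grows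
like `2 ^ (κ i)`, the reciprocal of Markov's tail decay. -/
lemma sq_gridPoint_div_regionSamples_le {cN κ σ ε : ℝ} (hcN : 0 < cN) (hσ : 0 < σ) (hε : 0 < ε)
    (i : ℕ) : (σ * gridPoint (i + 1)) ^ 2 / regionSamples cN κ σ ε (i + 1) ≤
      ε ^ 2 / cN * ((2 : ℝ) ^ κ) ^ (i + 1) := by
  have hpos : (0 : ℝ) < regionSamples cN κ σ ε (i + 1) := by
    exact_mod_cast regionSamples_pos hcN hσ hε (i + 1)
  have h1 : cN * (σ / ε) ^ 2 * (2 : ℝ) ^ (((i + 1 : ℕ) : ℝ) * (2 - κ)) ≤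
      regionSamples cN κ σ ε (i + 1) := Nat.le_ceil _
  have h2 : (2 : ℝ) ^ (((i + 1 : ℕ) : ℝ) * (2 - κ)) * ((2 : ℝ) ^ κ) ^ (i + 1) =
      (2 ^ (i + 1)) ^ 2 := by
    rw [← Real.rpow_natCast ((2 : ℝ) ^ κ), ← Real.rpow_mul two_pos.le, ← Real.rpow_add two_pos,
      ← pow_mul, ← Real.rpow_natCast 2]
    congr 1
    push_cast
    ring
  rw [div_le_iff₀ hpos, gridPoint_succ]
  calc (σ * 2 ^ (i + 1)) ^ 2 = ε ^ 2 / cN * ((2 : ℝ) ^ κ) ^ (i + 1) *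
        (cN * (σ / ε) ^ 2 * (2 : ℝ) ^ (((i + 1 : ℕ) : ℝ) * (2 - κ))) := by
        rw [mul_pow, ← h2]
        field_simp
    _ ≤ _ := by gcongr

/-- Markov's inequality region by region would cost a factor `N`, so the sum is taken inside the
integral and bounded pointwise. In the constant, `221201 = 1 + 2 * 110600`, the exponent shift costs
`2 ^ κ ≤ 8`, and there are two signs. -/
lemma sum_tail_le {κ lam σ c : ℝ} (hκ : 1 < κ) (hκ3 : κ ≤ 3) (hσ : 0 < σ) {D : Measure ℝ}
    (hD : D ∈ momentFamily κ lam σ) (hc : |c - ∫ y, y ∂D| ≤ 24 * σ) (N : ℕ) :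
    ∑ i : Fin N, ∑ b : Bool, ((2 : ℝ) ^ κ) ^ ((i : ℕ) + 1) *
      ∫ x, (if σ * gridPoint i ≤ signOf b * (x - c) then 1 else 0) ∂D ≤ 16 * 221201 := by
  have hP := hD.1
  obtain ⟨hint, hmom⟩ := recentred_moment_le hκ hκ3 hσ hD hc
  have h8 : (2 : ℝ) ^ κ ≤ 8 := by
    calc (2 : ℝ) ^ κ ≤ 2 ^ (3 : ℝ) := Real.rpow_le_rpow_of_exponent_le one_le_two hκ3
      _ = 8 := by norm_num
  have hI : ∀ (i : ℕ) (b : Bool), Integrable (fun x : ℝ =>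
      if σ * gridPoint i ≤ signOf b * (x - c) then (1 : ℝ) else 0) D := fun i b =>
    Integrable.of_bound (Measurable.ite (measurableSet_le measurable_const (by fun_prop))
      measurable_const measurable_const).aestronglyMeasurable 1
      (Filter.Eventually.of_forall fun x => by split_ifs <;> simp)
  have hb : ∀ b : Bool, ∑ i : Fin N, ((2 : ℝ) ^ κ) ^ ((i : ℕ) + 1) *
      ∫ x, (if σ * gridPoint i ≤ signOf b * (x - c) then 1 else 0) ∂D ≤ 8 * 221201 := by
    intro b
    have hpt : ∀ x : ℝ, ∑ i ∈ Finset.range N, ((2 : ℝ) ^ κ) ^ (i + 1) *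
        (if σ * gridPoint i ≤ signOf b * (x - c) then (1 : ℝ) else 0) ≤
        8 * (1 + 2 * (|x - c| ^ κ / σ ^ κ)) := by
      intro x
      have h1 := sum_grid_indicator_le hκ.le N (signOf b * (x - c) / σ)
      have h2 : |signOf b * (x - c) / σ| ^ κ = |x - c| ^ κ / σ ^ κ := by
        rw [abs_div, abs_mul, abs_of_pos hσ, Real.div_rpow (by positivity) hσ.le]
        cases b <;> simp [signOf]
      have h3 : ∀ i, (gridPoint i ≤ signOf b * (x - c) / σ) =
          (σ * gridPoint i ≤ signOf b * (x - c)) := by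
        intro i
        rw [le_div_iff₀ hσ, mul_comm]
      simp only [h2, h3] at h1
      have h4 : (0 : ℝ) ≤ |x - c| ^ κ / σ ^ κ := by positivity
      simp only [pow_succ', mul_assoc, ← Finset.mul_sum]
      calc _ ≤ (2 : ℝ) ^ κ * (1 + 2 * (|x - c| ^ κ / σ ^ κ)) := by gcongr
        _ ≤ _ := by gcongr
    rw [Fin.sum_univ_eq_sum_range (fun i => ((2 : ℝ) ^ κ) ^ (i + 1) *
      ∫ x, (if σ * gridPoint i ≤ signOf b * (x - c) then (1 : ℝ) else 0) ∂D) N]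
    simp only [← integral_const_mul]
    rw [← integral_finsetSum _ fun i _ => (hI i b).const_mul _]
    have hbd : Integrable (fun x => 8 * (1 + 2 * (|x - c| ^ κ / σ ^ κ))) D :=
      ((integrable_const _).add ((hint.div_const _).const_mul _)).const_mul _
    refine (integral_mono (integrable_finsetSum _ fun i _ => (hI i b).const_mul _) hbd hpt).trans ?_
    rw [integral_const_mul, integral_add (integrable_const _) ((hint.div_const _).const_mul _),
      integral_const_mul, integral_div]
    simp only [integral_const, probReal_univ, one_smul]
    have h5 : (∫ x, |x - c| ^ κ ∂D) / σ ^ κ ≤ 110600 := by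
      rw [div_le_iff₀ (by positivity)]
      exact hmom
    linarith
  rw [Finset.sum_comm, Fintype.sum_bool]
  linarith [hb true, hb false]

/-- A base estimate has error more than `ε` with probability at most `1/4`. -/
lemma measureReal_batch_fails_le {κ lam σ ε c : ℝ} (hκ : 1 < κ) (hκ3 : κ ≤ 3) (hε : 0 < ε)
    (hεσ : ε ≤ σ) {D : Measure ℝ} (hD : D ∈ momentFamily κ lam σ)
    (hc : |c - ∫ y, y ∂D| ≤ 24 * σ) :
    (Measure.pi fun _ : (Σ i : Fin (numRegions (cutoffConst κ) κ σ ε),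
        Bool × Fin 4 × Fin (regionSamples allocationConst κ σ ε (i + 1))) =>
      (volume : Measure unitInterval).prod D).real
      {w | ε < |∑ s, slotTerm σ c (fun i => regionSamples allocationConst κ σ ε (i + 1)) s (w s) -
        ((∫ y, y ∂D) - c)|} ≤ 1 / 4 := by
  have hP := hD.1
  have hσ : 0 < σ := hε.trans_le hεσ
  have hcN : 0 < allocationConst := by norm_num [allocationConst]
  set N := numRegions (cutoffConst κ) κ σ ε with hN
  set n : ℕ → ℕ := fun i => regionSamples allocationConst κ σ ε (i + 1) with hn
  have hn0 : ∀ i, 0 < n i := fun i => regionSamples_pos hcN hσ hε (i + 1)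
  set ν := (volume : Measure unitInterval).prod D
  set S := Σ i : Fin N, Bool × Fin 4 × Fin (n i)
  have hL : ∀ s : S, MemLp (slotTerm σ c n s) 2 ν := fun s => memLp_slotTerm σ c n s ν 2
  set π := Measure.pi fun _ : S => ν
  set X : (S → unitInterval × ℝ) → ℝ := ∑ s, fun w => slotTerm σ c n s (w s) with hX
  have hLpi : ∀ s : S, MemLp (fun w : S → unitInterval × ℝ => slotTerm σ c n s (w s)) 2 π :=
    fun s => (hL s).comp_measurePreserving (measurePreserving_eval (fun _ : S => ν) s)
  have hXL : MemLp X 2 π := memLp_finsetSum' _ fun s _ => hLpi s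
  have hXe : ∀ w, X w = ∑ s, slotTerm σ c n s (w s) := fun w => by simp [hX]
  have hmean : ∫ w, X w ∂π = ∫ x, (truncBelow (σ * gridPoint N) (x - c) -
      truncBelow (σ * gridPoint N) (-(x - c))) ∂D := by
    simp only [hXe]
    rw [integral_finsetSum _ fun s _ => (hLpi s).integrable one_le_two,
      ← sum_integral_slotTerm hσ c hn0 D]
    refine Finset.sum_congr rfl fun s _ => ?_
    exact integral_comp_eval (μ := fun _ : S => ν) (i := s) (hL s).aestronglyMeasurable
  have hvar : ProbabilityTheory.variance X π ≤ ε ^ 2 / 16 := by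
    rw [hX, ProbabilityTheory.variance_sum_pi (μ := fun _ : S => ν) hL]
    refine (sum_variance_slotTerm_le hσ c hn0 D).trans ?_
    calc _ ≤ ∑ i : Fin N, ∑ b : Bool, 4 * (ε ^ 2 / allocationConst * ((2 : ℝ) ^ κ) ^ ((i : ℕ) + 1)) *
            ∫ x, (if σ * gridPoint i ≤ signOf b * (x - c) then 1 else 0) ∂D := by
          refine Finset.sum_le_sum fun i _ => Finset.sum_le_sum fun b _ => ?_
          refine mul_le_mul_of_nonneg_right ?_ (integral_nonneg fun x => ?_)
          · exact mul_le_mul_of_nonneg_left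
              (sq_gridPoint_div_regionSamples_le hcN hσ hε i) (by norm_num)
          · show (0 : ℝ) ≤ ite _ _ _
            split_ifs <;> norm_num
      _ = 4 * (ε ^ 2 / allocationConst) * ∑ i : Fin N, ∑ b : Bool, ((2 : ℝ) ^ κ) ^ ((i : ℕ) + 1) *
            ∫ x, (if σ * gridPoint i ≤ signOf b * (x - c) then 1 else 0) ∂D := by
          simp only [Finset.mul_sum, mul_assoc]
      _ ≤ 4 * (ε ^ 2 / allocationConst) * (16 * 221201) := by
          gcongr
          exact sum_tail_le hκ hκ3 hσ hD hc N
      -- `4 * 16 * 221201 * 16` is below `10 ^ 9`. A variance of `ε² / 16` makes a deviation of `ε /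
      -- 2` have probability at most `1/4`; the other `ε / 2` is the bias.
      _ ≤ ε ^ 2 / 16 := by
          unfold allocationConst
          nlinarith [sq_nonneg ε]
  have hbias := bias_le hκ hκ3 hε hεσ hD hc
  rw [← hN, ← hmean] at hbias
  have hcheb := ProbabilityTheory.meas_ge_le_variance_div_sq hXL (half_pos hε)
  have hsub : {w : S → unitInterval × ℝ | ε < |∑ s, slotTerm σ c n s (w s) - ((∫ y, y ∂D) - c)|} ⊆
      {w | ε / 2 ≤ |X w - ∫ w, X w ∂π|} := by
    intro w hw
    simp only [Set.mem_ofPred_eq, ← hXe] at hw ⊢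
    have := abs_sub_le (X w) (∫ w, X w ∂π) ((∫ y, y ∂D) - c)
    linarith
  refine ENNReal.toReal_le_of_le_ofReal (by norm_num) ((measure_mono hsub).trans (hcheb.trans ?_))
  apply ENNReal.ofReal_le_ofReal
  rw [div_le_iff₀ (by positivity)]
  linarith

/-! ### Amplification by the median and combination of the two rounds. -/

/-- For a centre close to the mean, the median of the base estimates has error more than `ε` with
probability at most `δ / 2`. -/
lemma measure_refinement_fails_le {κ lam σ ε δ c : ℝ} (hκ : 1 < κ) (hκ3 : κ ≤ 3) (hε : 0 < ε)
    (hεσ : ε ≤ σ) (hδ : 0 < δ) {D : Measure ℝ} (hD : D ∈ momentFamily κ lam σ)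
    (hc : |c - ∫ y, y ∂D| ≤ 24 * σ) :
    (Measure.pi fun _ : RefinementSlot (cutoffConst κ) allocationConst κ σ ε δ =>
      (volume : Measure unitInterval).prod D)
      {w | ε < |c + median (baseEstimate fun r => refinementQuery c r (w r).1 (w r).2) -
        ∫ y, y ∂D|} ≤ ENNReal.ofReal (δ / 2) := by
  have hP := hD.1
  set K := numBatches δ
  set n : ℕ → ℕ := fun i => regionSamples allocationConst κ σ ε (i + 1) with hn
  set S := Σ i : Fin (numRegions (cutoffConst κ) κ σ ε), Bool × Fin 4 × Fin (n i) with hS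
  set ν := (volume : Measure unitInterval).prod D
  set m := (∫ y, y ∂D) - c with hm
  set A : (S → unitInterval × ℝ) → Bool := fun w => decide (ε < |∑ s, slotTerm σ c n s (w s) - m|)
    with hA
  have hAset : MeasurableSet {w : S → unitInterval × ℝ | ε < |∑ s, slotTerm σ c n s (w s) - m|} := by
    refine measurableSet_lt measurable_const ?_
    have : ∀ s : S, Measurable (slotTerm σ c n s) := fun s =>
      (measurable_hitIndicator _ _ _ _ _).const_mul _
    have h2 : Measurable fun w : S → unitInterval × ℝ => ∑ s, slotTerm σ c n s (w s) :=
      Finset.measurable_sum _ fun s _ => (this s).comp (measurable_pi_apply s)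
    exact (h2.sub_const m).abs
  have hAm : Measurable A := measurable_to_bool (by simpa [hA, Set.preimage] using hAset)
  have hind : ProbabilityTheory.iIndepFun
      (fun (j : Fin K) (W : Fin K → S → unitInterval × ℝ) => A (W j))
      (Measure.pi fun _ : Fin K => Measure.pi fun _ : S => ν) :=
    ProbabilityTheory.iIndepFun_pi (X := fun _ => A) fun _ => hAm.aemeasurable
  have hbound := measureReal_half_le_card_le_exp
    (fun j : Fin K => hAm.comp (measurable_pi_apply j)) hind (fun j => by
      have h1 := (measurePreserving_eval (fun _ : Fin K => Measure.pi fun _ : S => ν)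
        j).measureReal_preimage hAset.nullMeasurableSet
      have h2 := measureReal_batch_fails_le hκ hκ3 hε hεσ hD hc
      refine le_trans (le_of_eq ?_) h2
      rw [← h1]
      congr 1
      ext W
      simp [hA])
  -- Currying the product over pairs (batch, slot) makes the batches coordinates of a product
  -- measure, hence independent.
  have hcurry : MeasurePreserving (MeasurableEquiv.curry (Fin K) S (unitInterval × ℝ))
      (Measure.pi fun _ : Fin K × S => ν) (Measure.pi fun _ : Fin K => Measure.pi fun _ : S => ν) := by
    refine ⟨MeasurableEquiv.measurable _, ?_⟩
    have := Measure.infinitePi_map_curry (ι := Fin K) (κ := S) (fun _ _ => ν)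
    simpa only [Measure.infinitePi_eq_pi] using this
  have hsub : {w : RefinementSlot (cutoffConst κ) allocationConst κ σ ε δ → unitInterval × ℝ |
      ε < |c + median (baseEstimate fun r => refinementQuery c r (w r).1 (w r).2) - ∫ y, y ∂D|} ⊆
      MeasurableEquiv.curry (Fin K) S (unitInterval × ℝ) ⁻¹'
        {W | K ≤ 2 * (Finset.univ.filter fun j => A (W j) = true).card} := by
    intro w hw
    by_contra hcon
    simp only [Set.mem_preimage, Set.mem_ofPred_eq, not_le] at hcon
    rw [Set.mem_ofPred_eq] at hw
    refine not_le.2 hw ?_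
    have h1 : c + median (baseEstimate fun r => refinementQuery c r (w r).1 (w r).2) - ∫ y, y ∂D =
        median (baseEstimate fun r => refinementQuery c r (w r).1 (w r).2) - m := by
      rw [hm]
      ring
    rw [h1]
    apply abs_median_sub_le
    refine lt_of_eq_of_lt ?_ hcon
    congr 2
    ext j
    simp only [Finset.mem_filter, Finset.mem_univ, true_and, hA, decide_eq_true_eq]
    rw [baseEstimate_eq_sum]
    rfl
  refine (measure_mono hsub).trans ?_
  rw [hcurry.measure_preimage_equiv, ← ofReal_measureReal]
  apply ENNReal.ofReal_le_ofReal
  refine hbound.trans ?_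
  have h1 : 8 * Real.log (2 / δ) ≤ K := Nat.le_ceil _
  have h2 : Real.exp (-(K : ℝ) / 8) ≤ Real.exp (-Real.log (2 / δ)) := by
    apply Real.exp_le_exp.2
    linarith
  rwa [Real.exp_neg, Real.exp_log (by positivity), inv_div] at h2

/-- Separation of the samples of the two rounds, with the seed attached to the second. -/
lemma measurePreserving_splitRounds {A R : Type*} [Fintype A] [Fintype R] {α β : Type*}
    [MeasurableSpace α] [MeasurableSpace β] (ν : Measure α) [IsProbabilityMeasure ν]
    (D : Measure β) [IsProbabilityMeasure D] :
    MeasurePreserving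
      (fun p : (R → α) × (A ⊕ R → β) => (fun a => p.2 (Sum.inl a), fun r => (p.1 r, p.2 (Sum.inr r))))
      ((Measure.pi fun _ : R => ν).prod (Measure.pi fun _ : A ⊕ R => D))
      ((Measure.pi fun _ : A => D).prod (Measure.pi fun _ : R => ν.prod D)) := by
  have h1 := (MeasurePreserving.id (Measure.pi fun _ : R => ν)).prod
    (measurePreserving_sumPiEquivProdPi (X := fun _ : A ⊕ R => β) fun _ => D)
  have h2 := (measurePreserving_prodAssoc (Measure.pi fun _ : A => D) (Measure.pi fun _ : R => D)
    (Measure.pi fun _ : R => ν)).comp (Measure.measurePreserving_swap.comp h1)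
  have h3 := ((MeasurePreserving.id (Measure.pi fun _ : A => D)).prod
    (((measurePreserving_arrowProdEquivProdArrow α β R (fun _ => ν) fun _ => D).symm).comp
      Measure.measurePreserving_swap)).comp h2
  exact h3

lemma OneBitEstimator.answer_eq (E : OneBitEstimator) (s : E.Seed) (x : E.Slot → ℝ) (i : E.Slot) :
    E.answer s x i = E.query i s
      (fun j => if E.round j < E.round i then E.answer s x j else false) (x i) := by
  rw [OneBitEstimator.answer]
  simp only [dite_eq_ite]

/-- The first round ignores all answers and the second uses only those of the first, so the
recursion defining the answers closes after two unfoldings. -/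
lemma twoStageCore_output {cT cN κ lam σ ε δ : ℝ} (s : (twoStageCore cT cN κ lam σ ε δ).Seed)
    (x : (twoStageCore cT cN κ lam σ ε δ).Slot → ℝ) :
    (twoStageCore cT cN κ lam σ ε δ).output s x =
      localizationCenter lam (M := grayBits κ lam σ) (J := graySamples (grayBits κ lam σ) δ)
        (fun p => grayFun (p.1 + 1) ((x (Sum.inl p) + lam) / (2 * lam))) +
      median (baseEstimate fun r : RefinementSlot cT cN κ σ ε δ =>
        refinementQuery (localizationCenter lam (M := grayBits κ lam σ)
          (J := graySamples (grayBits κ lam σ) δ)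
          fun p => grayFun (p.1 + 1) ((x (Sum.inl p) + lam) / (2 * lam))) r (s r)
          (x (Sum.inr r))) := by
  let E := twoStageCore cT cN κ lam σ ε δ
  have h1 : (fun p : Fin (grayBits κ lam σ) × Fin (graySamples (grayBits κ lam σ) δ) =>
      E.answer s x (Sum.inl p)) =
      fun p => grayFun (p.1 + 1) ((x (Sum.inl p) + lam) / (2 * lam)) :=
    funext fun p => (E.answer_eq s x (Sum.inl p)).trans rfl
  have h2 : (fun r : RefinementSlot cT cN κ σ ε δ => E.answer s x (Sum.inr r)) =
      fun r => refinementQuery (localizationCenter lam fun p => E.answer s x (Sum.inl p)) r (s r)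
        (x (Sum.inr r)) :=
    funext fun r => (E.answer_eq s x (Sum.inr r)).trans rfl
  have h3 : E.output s x = localizationCenter lam (fun p => E.answer s x (Sum.inl p)) +
      median (baseEstimate fun r : RefinementSlot cT cN κ σ ε δ => E.answer s x (Sum.inr r)) := rfl
  rw [h2, h1] at h3
  exact h3

lemma twoStageCore_isPAC {κ lam σ ε δ : ℝ} (hκ : 1 < κ) (hκ3 : κ ≤ 3) (hε : 0 < ε) (hεσ : ε ≤ σ)
    (hlam : 0 < lam) (hδ : 0 < δ) :
    (twoStageCore (cutoffConst κ) allocationConst κ lam σ ε δ).IsPAC (momentFamily κ lam σ) ε δ := by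
  intro D hD
  have hP := hD.1
  have hσ : 0 < σ := hε.trans_le hεσ
  set E := twoStageCore (cutoffConst κ) allocationConst κ lam σ ε δ with hE
  set μ := ∫ x, x ∂D with hμ
  set M := grayBits κ lam σ
  set J := graySamples M δ
  let R := RefinementSlot (cutoffConst κ) allocationConst κ σ ε δ
  let bits : (Fin M × Fin J → ℝ) → Fin M × Fin J → Bool := fun x p =>
    grayFun (p.1 + 1) ((x p + lam) / (2 * lam))
  -- The closeness of the centre is part of the bad event, so `T y` is empty for a bad bit vector
  -- and the bound `δ / 2` holds uniformly in `y`.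
  let T : (Fin M × Fin J → Bool) → Set (R → unitInterval × ℝ) := fun y =>
    {w | |localizationCenter lam y - μ| ≤ 24 * σ ∧ ε < |localizationCenter lam y +
      median (baseEstimate fun r : R =>
        refinementQuery (localizationCenter lam y) r (w r).1 (w r).2) - μ|}
  set P1 := Measure.pi fun _ : Fin M × Fin J => D
  set P2 := Measure.pi fun _ : R => (volume : Measure unitInterval).prod D
  have hT : ∀ y, P2 (T y) ≤ ENNReal.ofReal (δ / 2) := by
    intro y
    by_cases hy : |localizationCenter lam y - μ| ≤ 24 * σ
    · exact (measure_mono fun w hw => hw.2).trans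
        (measure_refinement_fails_le hκ hκ3 hε hεσ hδ hD hy)
    · have : T y = ∅ := by
        ext w
        simp only [T, Set.mem_ofPred_eq, Set.mem_empty_iff_false, iff_false]
        exact fun h => hy h.1
      rw [this, measure_empty]
      exact zero_le
  have hbits : Measurable bits := measurable_pi_lambda _ fun p =>
    (measurable_grayFun _).comp (by fun_prop)
  have hB2 : (P1.prod P2) {q | q.2 ∈ T (bits q.1)} ≤ ENNReal.ofReal (δ / 2) :=
    measure_prod_le_of_finite (fun a => hbits (measurableSet_singleton a)) hT
  have hB1 : (P1.prod P2) ({x | 24 * σ < |localizationCenter lam (bits x) - μ|} ×ˢ Set.univ) ≤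
      ENNReal.ofReal (δ / 2) := by
    rw [Measure.prod_prod, measure_univ, mul_one, ← ofReal_measureReal]
    exact ENNReal.ofReal_le_ofReal (measureReal_localization_fails_le hκ.le hσ hlam hδ hD)
  have hΦ := measurePreserving_splitRounds (A := Fin M × Fin J) (R := R)
    (volume : Measure unitInterval) D
  set good : Set (E.Seed × (E.Slot → ℝ)) := {p | |E.output p.1 p.2 - μ| ≤ ε}
  set Q := E.seedLaw.prod (Measure.pi fun _ : E.Slot => D)
  have hsub : goodᶜ ⊆ (fun p : (R → unitInterval) × ((Fin M × Fin J) ⊕ R → ℝ) =>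
      (fun a => p.2 (Sum.inl a), fun r => (p.1 r, p.2 (Sum.inr r)))) ⁻¹'
      (({x | 24 * σ < |localizationCenter lam (bits x) - μ|} ×ˢ Set.univ) ∪
        {q | q.2 ∈ T (bits q.1)}) := by
    rintro ⟨s, x⟩ hp
    by_cases h : |localizationCenter lam (bits fun a => x (Sum.inl a)) - μ| ≤ 24 * σ
    · right
      refine ⟨h, ?_⟩
      have h1 : ¬ |E.output s x - μ| ≤ ε := hp
      rw [twoStageCore_output, not_le] at h1
      exact h1
    · left
      exact ⟨not_le.1 h, trivial⟩
  have hbad : Q goodᶜ ≤ ENNReal.ofReal δ := by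
    calc Q goodᶜ ≤ _ := measure_mono hsub
      _ ≤ (P1.prod P2) (({x | 24 * σ < |localizationCenter lam (bits x) - μ|} ×ˢ Set.univ) ∪
        {q | q.2 ∈ T (bits q.1)}) := hΦ.measure_preimage_le _
      _ ≤ ENNReal.ofReal (δ / 2) + ENNReal.ofReal (δ / 2) :=
        (measure_union_le _ _).trans (add_le_add hB1 hB2)
      _ = ENNReal.ofReal δ := by
        rw [← ENNReal.ofReal_add (by positivity) (by positivity), add_halves]
  -- Passing from the bad event to the good one needs only subadditivity, so the measurability of
  -- the output plays no role.
  rw [ENNReal.ofReal_sub _ hδ.le, ENNReal.ofReal_one, tsub_le_iff_right]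
  calc (1 : ENNReal) = Q Set.univ := measure_univ.symm
    _ = Q (good ∪ goodᶜ) := by rw [Set.union_compl_self]
    _ ≤ Q good + Q goodᶜ := measure_union_le _ _
    _ ≤ Q good + ENNReal.ofReal δ := by gcongr

/-! ### Query types and the number of samples. -/

lemma isThresholdQuery_refinementQuery {cT cN κ σ ε δ : ℝ} (c : ℝ)
    (r : RefinementSlot cT cN κ σ ε δ) (u : ℝ) : IsThresholdQuery (refinementQuery c r u) := by
  set t := queryThreshold r.2.2.2.1 (σ * gridPoint r.2.1) (σ * gridPoint (r.2.1 + 1)) u with ht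
  have h : ∀ x, refinementQuery c r u x = true ↔ t ≤ signOf r.2.2.1 * (x - c) := fun x => by
    simp [refinementQuery, ht]
  cases hb : r.2.2.1
  · refine ⟨c - t, Or.inl fun x => ?_⟩
    rw [h, hb]
    simp only [signOf, Bool.false_eq_true, if_false]
    constructor <;> intro h' <;> linarith
  · refine ⟨c + t, Or.inr fun x => ?_⟩
    rw [h, hb]
    simp only [signOf, if_true]
    constructor <;> intro h' <;> linarith

lemma twoStageCore_numSamples (cT cN κ lam σ ε δ : ℝ) :
    (twoStageCore cT cN κ lam σ ε δ).numSamples =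
      grayBits κ lam σ * graySamples (grayBits κ lam σ) δ +
        numBatches δ * ∑ i ∈ Finset.range (numRegions cT κ σ ε),
          2 * (4 * regionSamples cN κ σ ε (i + 1)) := by
  have h : (twoStageCore cT cN κ lam σ ε δ).numSamples =
      Fintype.card ((Fin (grayBits κ lam σ) × Fin (graySamples (grayBits κ lam σ) δ)) ⊕
        RefinementSlot cT cN κ σ ε δ) := rfl
  rw [h]
  simp only [Fintype.card_sum, Fintype.card_prod, Fintype.card_sigma, Fintype.card_fin,
    Fintype.card_bool]
  rw [Fin.sum_univ_eq_sum_range fun i => 2 * (4 * regionSamples cN κ σ ε (i + 1))]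

lemma localization_samples_le {κ lam σ δ : ℝ} (hκ : 0 < κ) (hσ : 0 < σ) (hlam : σ ≤ lam)
    (hδ : 0 < δ) (hδ1 : δ < 1) :
    ((grayBits κ lam σ * graySamples (grayBits κ lam σ) δ : ℕ) : ℝ) ≤
      40 * (Real.log (lam / σ) * max 1 (Real.log (Real.log (lam / σ) / δ))) := by
  have hL0 : 0 ≤ Real.log (lam / σ) := Real.log_nonneg ((one_le_div hσ).2 hlam)
  set L := Real.log (lam / σ) with hL
  set Z := max 1 (Real.log (L / δ)) with hZ
  have hZ1 : 1 ≤ Z := le_max_left _ _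
  have hZ2 : Real.log (L / δ) ≤ Z := le_max_right _ _
  rcases Nat.eq_zero_or_pos (grayBits κ lam σ) with h | h
  · rw [h]
    simp only [zero_mul, Nat.cast_zero]
    positivity
  have h0 : 1 ≤ Real.logb 2 (lam / σ) - 1 - 2 / κ := Nat.floor_pos.1 h
  have h1 : (grayBits κ lam σ : ℝ) ≤ Real.logb 2 (lam / σ) - 1 - 2 / κ :=
    Nat.floor_le (zero_le_one.trans h0)
  set M := grayBits κ lam σ
  have hM1 : (1 : ℝ) ≤ M := by exact_mod_cast h
  have h2 : 0 < 2 / κ := by positivity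
  have h3 : (M : ℝ) ≤ 3 / 2 * L := by
    have h4 : Real.logb 2 (lam / σ) ≤ 3 / 2 * L := by
      rw [Real.logb, ← hL, div_le_iff₀ (Real.log_pos one_lt_two)]
      nlinarith [Real.log_two_gt_d9]
    linarith
  have hLpos : 0 < L := by linarith
  have h5 : Real.log (2 * M / δ) ≤ 2 + Z := by
    calc Real.log (2 * M / δ) ≤ Real.log (3 * (L / δ)) := by
          apply Real.log_le_log (by positivity)
          rw [mul_div_assoc', div_le_div_iff_of_pos_right hδ]
          linarith
      _ = Real.log 3 + Real.log (L / δ) := Real.log_mul (by norm_num) (by positivity)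
      _ ≤ 2 + Z := by
          have := Real.log_le_sub_one_of_pos (show (0 : ℝ) < 3 by norm_num)
          linarith
  have h6 : 0 ≤ Real.log (2 * M / δ) := by
    apply Real.log_nonneg
    rw [one_le_div hδ]
    linarith
  have h7 : (graySamples M δ : ℝ) < 8 * Real.log (2 * M / δ) + 1 :=
    Nat.ceil_lt_add_one (by positivity)
  -- `8 * (2 + Z) + 1 ≤ 25 * Z` because `Z ≥ 1`; multiplied by `3/2` this stays below 40.
  have h8 : (graySamples M δ : ℝ) ≤ 25 * Z := by linarith
  push_cast
  calc (M : ℝ) * graySamples M δ ≤ 3 / 2 * L * (25 * Z) := by gcongr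
    _ ≤ 40 * (L * Z) := by nlinarith [mul_pos hLpos (zero_lt_one.trans_le hZ1)]

lemma numBatches_le {δ : ℝ} (hδ : 0 < δ) (hδ1 : δ < 1) :
    (numBatches δ : ℝ) ≤ 17 * max 1 (Real.log (1 / δ)) := by
  have h1 : Real.log (2 / δ) = Real.log 2 + Real.log (1 / δ) := by
    rw [← Real.log_mul (by norm_num) (by positivity)]
    congr 1
    ring
  have h2 := Real.log_le_sub_one_of_pos (show (0 : ℝ) < 2 by norm_num)
  have h3 : 0 ≤ Real.log (1 / δ) := Real.log_nonneg ((one_le_div hδ).2 hδ1.le)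
  have h4 := Real.log_pos (one_lt_two (α := ℝ))
  have h5 : (numBatches δ : ℝ) < 8 * Real.log (2 / δ) + 1 := Nat.ceil_lt_add_one (by linarith)
  linarith [le_max_left 1 (Real.log (1 / δ)), le_max_right 1 (Real.log (1 / δ))]

lemma exists_numRegions_le {κ : ℝ} (hκ : 1 < κ) : ∃ A : ℝ, 0 < A ∧ ∀ σ ε : ℝ, 0 < ε → ε ≤ σ →
    (numRegions (cutoffConst κ) κ σ ε : ℝ) ≤ A * max 1 (Real.log (σ / ε)) := by
  have hκ1 : 0 < κ - 1 := by linarith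
  have hc := one_lt_cutoffConst hκ
  have ha : 0 < Real.logb 2 (cutoffConst κ) := Real.logb_pos one_lt_two hc
  have hl := Real.log_pos (one_lt_two (α := ℝ))
  refine ⟨Real.logb 2 (cutoffConst κ) + 1 / (κ - 1) / Real.log 2 + 1, by positivity, ?_⟩
  intro σ ε hε hεσ
  have hσ : 0 < σ := hε.trans_le hεσ
  have h1 : (numRegions (cutoffConst κ) κ σ ε : ℝ) <
      Real.logb 2 (cutoffConst κ * (σ / ε) ^ (1 / (κ - 1))) + 1 :=
    Nat.ceil_lt_add_one (Real.logb_pos one_lt_two (one_lt_cutoff hκ hε hεσ)).le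
  have h2 : Real.logb 2 (cutoffConst κ * (σ / ε) ^ (1 / (κ - 1))) =
      Real.logb 2 (cutoffConst κ) + 1 / (κ - 1) / Real.log 2 * Real.log (σ / ε) := by
    rw [Real.logb_mul (by positivity) (by positivity), Real.logb_rpow_eq_mul_logb_of_pos
      (by positivity), Real.logb, Real.logb]
    ring
  rw [h2] at h1
  set Z := max 1 (Real.log (σ / ε))
  have h3 : 1 ≤ Z := le_max_left _ _
  have h4 : Real.log (σ / ε) ≤ Z := le_max_right _ _
  have h5 : 1 / (κ - 1) / Real.log 2 * Real.log (σ / ε) ≤ 1 / (κ - 1) / Real.log 2 * Z := by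
    gcongr
  nlinarith

/-- The ceilings cost at most one sample per region, whence the summand `N`. What remains is a
geometric sum whose ratio `2 ^ (2 - κ)` separates the three regimes. -/
lemma sum_regionSamples_le {κ σ ε : ℝ} (hσ : 0 < σ) (hε : 0 < ε) (N : ℕ) :
    (∑ i ∈ Finset.range N, (regionSamples allocationConst κ σ ε (i + 1) : ℝ)) ≤
      allocationConst * (σ / ε) ^ 2 * ((2 : ℝ) ^ (2 - κ) *
        ∑ i ∈ Finset.range N, ((2 : ℝ) ^ (2 - κ)) ^ i) + N := by
  have h : ∀ i : ℕ, (regionSamples allocationConst κ σ ε (i + 1) : ℝ) ≤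
      allocationConst * (σ / ε) ^ 2 * ((2 : ℝ) ^ (2 - κ) * ((2 : ℝ) ^ (2 - κ)) ^ i) + 1 := by
    intro i
    have h1 : (2 : ℝ) ^ (2 - κ) * ((2 : ℝ) ^ (2 - κ)) ^ i =
        (2 : ℝ) ^ (((i + 1 : ℕ) : ℝ) * (2 - κ)) := by
      rw [← pow_succ', ← Real.rpow_natCast ((2 : ℝ) ^ (2 - κ)), ← Real.rpow_mul two_pos.le, mul_comm]
    rw [h1]
    have : 0 ≤ allocationConst := by norm_num [allocationConst]
    exact (Nat.ceil_lt_add_one (by positivity)).le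
  refine (Finset.sum_le_sum fun i _ => h i).trans (le_of_eq ?_)
  rw [Finset.sum_add_distrib, ← Finset.mul_sum, ← Finset.mul_sum]
  simp

lemma max_one_log_le {ρ : ℝ} (hρ : 1 ≤ ρ) : max 1 (Real.log ρ) ≤ ρ :=
  max_le hρ ((Real.log_le_sub_one_of_pos (by linarith)).trans (by linarith))

/-- Moments of order above two: the allocation decreases geometrically. -/
lemma exists_sum_regionSamples_le_of_two_lt {κ : ℝ} (hκ : 2 < κ) : ∃ A : ℝ, 0 < A ∧
    ∀ σ ε : ℝ, 0 < ε → ε ≤ σ →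
      (∑ i ∈ Finset.range (numRegions (cutoffConst κ) κ σ ε),
        (regionSamples allocationConst κ σ ε (i + 1) : ℝ)) ≤ A * (σ / ε) ^ 2 := by
  obtain ⟨A, hA, hN⟩ := exists_numRegions_le (show 1 < κ by linarith)
  set r : ℝ := 2 ^ (2 - κ) with hr
  have hr0 : 0 < r := by positivity
  have hr1 : r < 1 := Real.rpow_lt_one_of_one_lt_of_neg one_lt_two (by linarith)
  have hcN : 0 < allocationConst := by norm_num [allocationConst]
  have hr2 : 0 < 1 - r := by linarith
  refine ⟨allocationConst * (r * (1 - r)⁻¹) + A, by positivity, fun σ ε hε hεσ => ?_⟩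
  have hρ : 1 ≤ σ / ε := (one_le_div hε).2 hεσ
  have h1 := sum_regionSamples_le (κ := κ) (hε.trans_le hεσ) hε (numRegions (cutoffConst κ) κ σ ε)
  have h2 : ∑ i ∈ Finset.range (numRegions (cutoffConst κ) κ σ ε), r ^ i ≤ (1 - r)⁻¹ := by
    rw [← tsum_geometric_of_lt_one hr0.le hr1]
    exact (summable_geometric_of_lt_one hr0.le hr1).sum_le_tsum _ fun i _ => by positivity
  have h3 := hN σ ε hε hεσ
  have h4 : max 1 (Real.log (σ / ε)) ≤ (σ / ε) ^ 2 := (max_one_log_le hρ).trans (by nlinarith)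
  rw [← hr] at h1
  calc _ ≤ _ := h1
    _ ≤ allocationConst * (σ / ε) ^ 2 * (r * (1 - r)⁻¹) + A * (σ / ε) ^ 2 := by
      refine add_le_add ?_ (h3.trans ?_) <;> gcongr
    _ = _ := by ring

/-- Moments of order two: the allocation is constant. -/
lemma exists_sum_regionSamples_two_le : ∃ A : ℝ, 0 < A ∧
    ∀ σ ε : ℝ, 0 < ε → ε ≤ σ →
      (∑ i ∈ Finset.range (numRegions (cutoffConst 2) 2 σ ε),
        (regionSamples allocationConst 2 σ ε (i + 1) : ℝ)) ≤
        A * ((σ / ε) ^ 2 * max 1 (Real.log (σ / ε))) := by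
  obtain ⟨A, hA, hN⟩ := exists_numRegions_le (show (1 : ℝ) < 2 by norm_num)
  have hcN : 0 < allocationConst := by norm_num [allocationConst]
  refine ⟨(allocationConst + 1) * A, by positivity, fun σ ε hε hεσ => ?_⟩
  have hρ : 1 ≤ σ / ε := (one_le_div hε).2 hεσ
  have h1 := sum_regionSamples_le (κ := 2) (hε.trans_le hεσ) hε (numRegions (cutoffConst 2) 2 σ ε)
  simp only [sub_self, Real.rpow_zero, one_pow, one_mul, Finset.sum_const, Finset.card_range,
    nsmul_eq_mul, mul_one] at h1
  have h3 := hN σ ε hε hεσ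
  have h4 : (1 : ℝ) ≤ (σ / ε) ^ 2 := one_le_pow₀ hρ
  set N := (numRegions (cutoffConst 2) 2 σ ε : ℝ)
  have hN0 : 0 ≤ N := Nat.cast_nonneg _
  calc _ ≤ _ := h1
    _ ≤ allocationConst * (σ / ε) ^ 2 * N + (σ / ε) ^ 2 * N := by nlinarith
    _ = (allocationConst + 1) * (σ / ε) ^ 2 * N := by ring
    _ ≤ (allocationConst + 1) * (σ / ε) ^ 2 * (A * max 1 (Real.log (σ / ε))) := by gcongr
    _ = _ := by ring

/-- Moments of order below two: the allocation increases geometrically. -/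
lemma exists_sum_regionSamples_le_of_lt_two {κ : ℝ} (hκ : 1 < κ) (hκ2 : κ < 2) : ∃ A : ℝ, 0 < A ∧
    ∀ σ ε : ℝ, 0 < ε → ε ≤ σ →
      (∑ i ∈ Finset.range (numRegions (cutoffConst κ) κ σ ε),
        (regionSamples allocationConst κ σ ε (i + 1) : ℝ)) ≤ A * (σ / ε) ^ (κ / (κ - 1)) := by
  obtain ⟨A, hA, hN⟩ := exists_numRegions_le hκ
  set r : ℝ := 2 ^ (2 - κ) with hr
  have hr1 : 1 < r := Real.one_lt_rpow one_lt_two (by linarith)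
  have hr2 : 0 < r - 1 := by linarith
  have hcN : 0 < allocationConst := by norm_num [allocationConst]
  have hcT := one_lt_cutoffConst hκ
  have hκ1 : 0 < κ - 1 := by linarith
  set B : ℝ := (2 * cutoffConst κ) ^ (2 - κ) with hB
  have hB0 : 0 < B := by positivity
  refine ⟨allocationConst * (r / (r - 1) * B) + A, by positivity, fun σ ε hε hεσ => ?_⟩
  have hρ : 1 ≤ σ / ε := (one_le_div hε).2 hεσ
  have h1 := sum_regionSamples_le (κ := κ) (hε.trans_le hεσ) hε (numRegions (cutoffConst κ) κ σ ε)
  have h0 := one_lt_cutoff hκ hε hεσ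
  have hceil : (numRegions (cutoffConst κ) κ σ ε : ℝ) <
      Real.logb 2 (cutoffConst κ * (σ / ε) ^ (1 / (κ - 1))) + 1 :=
    Nat.ceil_lt_add_one (Real.logb_pos one_lt_two h0).le
  have h3 := hN σ ε hε hεσ
  set N := numRegions (cutoffConst κ) κ σ ε
  set ρ := σ / ε
  have hρ0 : 0 < ρ := by linarith
  -- Rounding up the number of regions at most doubles the cutoff.
  have hpow : (2 : ℝ) ^ N ≤ 2 * cutoffConst κ * ρ ^ (1 / (κ - 1)) := by
    have h5 : (N : ℝ) - 1 ≤ Real.logb 2 (cutoffConst κ * ρ ^ (1 / (κ - 1))) := by linarith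
    rw [Real.le_logb_iff_rpow_le one_lt_two (by linarith), Real.rpow_sub two_pos, Real.rpow_natCast,
      Real.rpow_one, div_le_iff₀ two_pos] at h5
    linarith
  have hrN : r ^ N ≤ B * ρ ^ ((2 - κ) / (κ - 1)) := by
    calc r ^ N = ((2 : ℝ) ^ N) ^ (2 - κ) := by
          rw [hr, ← Real.rpow_natCast, ← Real.rpow_natCast, ← Real.rpow_mul two_pos.le,
            ← Real.rpow_mul two_pos.le, mul_comm]
      _ ≤ (2 * cutoffConst κ * ρ ^ (1 / (κ - 1))) ^ (2 - κ) :=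
          Real.rpow_le_rpow (by positivity) hpow (by linarith)
      _ = B * ρ ^ ((2 - κ) / (κ - 1)) := by
          rw [Real.mul_rpow (by positivity) (by positivity), ← Real.rpow_mul hρ0.le]
          congr 2
          ring
  have h2 : ∑ i ∈ Finset.range N, r ^ i ≤ B * ρ ^ ((2 - κ) / (κ - 1)) / (r - 1) := by
    rw [geom_sum_eq hr1.ne']
    gcongr
    linarith
  -- The exponents combine as `2 + (2 - κ) / (κ - 1) = κ / (κ - 1)`.
  have h6 : ρ ^ 2 * ρ ^ ((2 - κ) / (κ - 1)) = ρ ^ (κ / (κ - 1)) := by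
    rw [← Real.rpow_natCast, ← Real.rpow_add hρ0]
    congr 1
    field_simp
    push_cast
    ring
  have h7 : max 1 (Real.log ρ) ≤ ρ ^ (κ / (κ - 1)) := by
    refine (max_one_log_le hρ).trans ?_
    conv_lhs => rw [← Real.rpow_one ρ]
    refine Real.rpow_le_rpow_of_exponent_le hρ ?_
    rw [one_le_div hκ1]
    linarith
  rw [← hr] at h1
  calc _ ≤ _ := h1
    _ ≤ allocationConst * ρ ^ 2 * (r * (B * ρ ^ ((2 - κ) / (κ - 1)) / (r - 1))) +
        A * ρ ^ (κ / (κ - 1)) := by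
      refine add_le_add ?_ (h3.trans ?_) <;> gcongr
    _ = allocationConst * (r / (r - 1) * B) * (ρ ^ 2 * ρ ^ ((2 - κ) / (κ - 1))) +
        A * ρ ^ (κ / (κ - 1)) := by ring
    _ = _ := by
      rw [h6]
      ring

lemma div_min_eq_max {σ ε : ℝ} (hσ : 0 < σ) (hε : 0 < ε) : σ / min ε σ = max 1 (σ / ε) := by
  rcases le_total ε σ with h | h
  · rw [min_eq_left h, max_eq_right ((one_le_div hε).2 h)]
  · rw [min_eq_right h, div_self hσ.ne', max_eq_left ((div_le_one hε).2 h)]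

/-- Capping the order at 3 keeps each `k` in its regime, and for `k > 2` the rate does not depend on
`k`. Capping the accuracy at `σ` turns the ratio into `ρ`. -/
lemma exists_refinement_samples_le {k : ℝ} (hk : 1 < k) : ∃ A : ℝ, 0 < A ∧
    ∀ σ ε δ : ℝ, 0 < σ → 0 < ε →
      (∑ i ∈ Finset.range (numRegions (cutoffConst (min k 3)) (min k 3) σ (min ε σ)),
        (regionSamples allocationConst (min k 3) σ (min ε σ) (i + 1) : ℝ)) *
          max 1 (Real.log (1 / δ)) ≤ A * refinementRate k σ ε δ := by
  rcases lt_trichotomy k 2 with h | h | h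
  · rw [min_eq_left (by linarith)]
    obtain ⟨A, hA, hs⟩ := exists_sum_regionSamples_le_of_lt_two hk h
    refine ⟨A, hA, fun σ ε δ hσ hε => ?_⟩
    have := hs σ (min ε σ) (lt_min hε hσ) (min_le_right _ _)
    rw [div_min_eq_max hσ hε] at this
    simp only [refinementRate, if_neg (not_lt.2 h.le), if_neg h.ne]
    rw [← mul_assoc]
    gcongr
  · subst h
    rw [min_eq_left (by norm_num)]
    obtain ⟨A, hA, hs⟩ := exists_sum_regionSamples_two_le
    refine ⟨A, hA, fun σ ε δ hσ hε => ?_⟩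
    have := hs σ (min ε σ) (lt_min hε hσ) (min_le_right _ _)
    rw [div_min_eq_max hσ hε] at this
    simp only [refinementRate, lt_irrefl, if_false, if_true]
    rw [← mul_assoc]
    gcongr
  · obtain ⟨A, hA, hs⟩ := exists_sum_regionSamples_le_of_two_lt
      (show 2 < min k 3 from lt_min h (by norm_num))
    refine ⟨A, hA, fun σ ε δ hσ hε => ?_⟩
    have := hs σ (min ε σ) (lt_min hε hσ) (min_le_right _ _)
    rw [div_min_eq_max hσ hε] at this
    simp only [refinementRate, if_pos h]
    rw [← mul_assoc]
    gcongr

theorem mainTheorem8 :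
    ∃ C₁ : ℝ, 0 < C₁ ∧ ∃ cN : ℝ, 0 < cN ∧
      ∀ k : ℝ, 1 < k →
        ∃ C₂ : ℝ, 0 < C₂ ∧ ∃ cT : ℝ, 0 < cT ∧
          ∀ lam σ ε δ : ℝ, 0 < σ → σ ≤ lam → 0 < ε → 0 < δ → δ < 1 →
            (twoStageEstimator cT cN k lam σ ε δ).IsPAC (momentFamily k lam σ) ε δ ∧
            ((twoStageEstimator cT cN k lam σ ε δ).numSamples : ℝ) ≤
              C₁ * (Real.log (lam / σ) * max 1 (Real.log (Real.log (lam / σ) / δ))) +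
                C₂ * refinementRate k σ ε δ ∧
            (twoStageEstimator cT cN k lam σ ε δ).rounds = 2 ∧
            ∀ i, ((twoStageEstimator cT cN k lam σ ε δ).round i : ℕ) = 1 →
              ∀ s y, IsThresholdQuery ((twoStageEstimator cT cN k lam σ ε δ).query i s y) := by
  refine ⟨40, by norm_num, allocationConst, by norm_num [allocationConst], fun k hk => ?_⟩
  have hκ : 1 < min k 3 := lt_min hk (by norm_num)
  obtain ⟨A, hA, hs⟩ := exists_refinement_samples_le hk
  -- `136 = 17 * 8`: 17 from the number of batches, and 8 for two signs times four kinds of queries.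
  refine ⟨136 * A, by positivity, cutoffConst (min k 3),
    zero_lt_one.trans (one_lt_cutoffConst hκ), ?_⟩
  intro lam σ ε δ hσ hlam hε hδ hδ1
  refine ⟨?_, ?_, rfl, ?_⟩
  -- The core estimator is correct for the larger family of order `min k 3` and the finer accuracy
  -- `min ε σ`.
  · intro D hD
    refine (twoStageCore_isPAC hκ (min_le_right _ _) (lt_min hε hσ) (min_le_right _ _)
      (hσ.trans_le hlam) hδ D (momentFamily_subset (zero_lt_one.trans hκ) (min_le_left _ _) hσ
        hD)).trans (measure_mono fun p hp => ?_)
    rw [Set.mem_ofPred_eq] at hp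
    exact hp.trans (min_le_left _ _)
  · rw [twoStageEstimator, twoStageCore_numSamples]
    rw [Nat.cast_add]
    refine add_le_add (localization_samples_le (zero_lt_one.trans hκ) hσ hlam hδ hδ1) ?_
    have h1 := numBatches_le hδ hδ1
    have h2 := hs σ ε δ hσ hε
    push_cast
    simp only [← Finset.mul_sum]
    set S := ∑ i ∈ Finset.range (numRegions (cutoffConst (min k 3)) (min k 3) σ (min ε σ)),
        (regionSamples allocationConst (min k 3) σ (min ε σ) (i + 1) : ℝ)
    have hS : 0 ≤ S := Finset.sum_nonneg fun i _ => Nat.cast_nonneg _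
    calc (numBatches δ : ℝ) * (2 * (4 * S))
        ≤ 17 * max 1 (Real.log (1 / δ)) * (2 * (4 * S)) := by gcongr
      _ = 136 * (S * max 1 (Real.log (1 / δ))) := by ring
      _ ≤ 136 * (A * refinementRate k σ ε δ) := by gcongr
      _ = 136 * A * refinementRate k σ ε δ := by ring
  · rintro (p | r) hi s y
    · exact absurd hi (by simp [twoStageEstimator, twoStageCore])
    · exact isThresholdQuery_refinementQuery _ r _
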